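/- Consider an uplink cell-free system with $M$ access points (APs) of $N$ antennas each, $K<N$ single-antenna devices, bandwidth $B>0$ and blocklength $L>K$; put $\eta=K/L$. The channel between AP $m$ and device $k$ is $\mathbf g_{m,k}=\sqrt{\beta_{m,k}}\,\mathbf h_{m,k}\in\mathbb C^N$ with $\beta_{m,k}>0$. The devices send orthonormal pilots $\mathbf q_1,\dots,\mathbf q_K\in\mathbb C^K$ with pilot powers $p_k^p>0$, and AP $m$ receives $\mathbf Y_m^p=\sum_k\sqrt{Kp_k^p}\,\mathbf g_{m,k}\mathbf q_k^H+\mathbf N_m^p$. The payload noise at AP $m$ is $\mathbf n_m\in\mathbb C^N$. All entries of all $\mathbf h_{m,k}$, $\mathbf N_m^p$, $\mathbf n_m$ are mutually independent $\mathcal{CN}(0,1)$ random variables. The MMSE channel estimate is $$\hat{\mathbf g}_{m,k}=\frac{Kp_k^p\beta_{m,k}}{Kp_k^p\beta_{m,k}+1}\cdot\frac{1}{\sqrt{Kp_k^p}}\mathbf Y_m^p\mathbf q_k,\qquad \lambda_{m,k}=\frac{Kp_k^p\beta_{m,k}^2}{Kp_k^p\beta_{m,k}+1},$$ and $\hat{\mathbf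 G}_m=[\hat{\mathbf g}_{m,1},\dots,\hat{\mathbf g}_{m,K}]$. The full-pilot zero-forcing (FZF) decoding vector is $\mathbf a_{m,k}=\mathbf v_{m,k}/\sqrt{\mathbb E\|\mathbf v_{m,k}\|^2}$ with $\mathbf v_{m,k}=\hat{\mathbf G}_m(\hat{\mathbf G}_m^H\hat{\mathbf G}_m)^{-1}\mathbf e_k$. Fix a device $k$ served by a nonempty set $\mathcal M_k$ of APs, with payload powers $p^d_k>0$ and $p^d_{k'}\ge 0$ for $k'\neq k$. Let $$\mathrm{DS}_k=\mathbb E\Big\{\sum_{m\in\mathcal M_k}\mathbf a_{m,k}^H\mathbf g_{m,k}\sqrt{p_k^d}\Big\},\quad \mathrm{LS}_k=\sqrt{p_k^d}\Big(\sum_{m\in\mathcal M_k}\mathbf a_{m,k}^H\mathbf g_{m,k}-\mathbb E\sum_{m\in\mathcal M_k}\mathbf a_{m,k}^H\mathbf g_{m,k}\Big),$$ $$\mathrm{UI}_{k,k'}=\sum_{m\in\mathcal M_k}\mathbf a_{m,k}^H\mathbf g_{m,k'}\sqrt{p_{k'}^d},\quad \mathrm N_k=\sum_{m\in\mathcal M_k}\mathbf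 a_{m,k}^H\mathbf n_m,\quad \gamma_k=\frac{|\mathrm{DS}_k|^2}{|\mathrm{LS}_k|^2+\sum_{k'\ne k}|\mathrm{UI}_{k,k'}|^2+|\mathrm N_k|^2}.$$ Let $Q(x)=\frac1{\sqrt{2\pi}}\int_x^\infty e^{-t^2/2}\,dt$, let $0<\varepsilon_k\le\frac12$ be the decoding error probability, and put $\alpha_k=Q^{-1}(\varepsilon_k)/\sqrt{L(1-\eta)}$. The finite-blocklength (FBL) rate at SINR $\gamma$ is $$R_k(\gamma)=B\Big[(1-\eta)\log_2(1+\gamma)-\sqrt{\tfrac{(1-\eta)(1-(1+\gamma)^{-2})}{L}}\,\tfrac{Q^{-1}(\varepsilon_k)}{\ln 2}\Big],$$ and the ergodic FBL rate is $\bar R_k=\mathbb E\{R_k(\gamma_k)\}$. Let $f_k(x)=\ln(1+\frac1x)-\alpha_k\sqrt{\frac{2x+1}{(x+1)^2}}$ and $$\hat\gamma_k^{\rm FZF}=\frac{p_k^d(N-K)\big(\sum_{m\in\mathcal M_k}\sqrt{\lambda_{m,k}}\big)^2}{|\mathcal M_k|+\sum_{k'=1}^K p_{k'}^d\sum_{m\in\mathcal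 M_k}(\beta_{m,k'}-\lambda_{m,k'})}.$$ Assume that $x=1/\hat\gamma_k^{\rm FZF}$ lies in the feasible region of $f_k$, that is, $\alpha_k\le g(x)$ with $g(x)=(x+1)\ln(1+\frac1x)/\sqrt{2x+1}$ (equivalently, $f_k(x)\ge0$). Then $R_k(\gamma_k)$ is integrable and $$\bar R_k\;\ge\; B\,\frac{1-\eta}{\ln 2}\,f_k\!\left(\frac1{\hat\gamma_k^{\rm FZF}}\right).$$ -/

import Mathlib

open MeasureTheory ProbabilityTheory
open scoped Matrix

namespace CellFree

noncomputable section

/-- The Gaussian tail function `Q(x) = (2π)^(-1/2) ∫_x^∞ exp(-t²/2) dt`. -/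
def Q (x : ℝ) : ℝ :=
  1 / √(2 * Real.pi) * ∫ t in Set.Ioi x, Real.exp (-t ^ 2 / 2)

/-- The inverse function of `Q` (meaningful on the range `(0, 1)` of `Q`). -/
def Qinv (ε : ℝ) : ℝ := Function.invFun Q ε

/-- The circularly symmetric law `CN(0, 1)` on `ℂ`: independent real and imaginary parts,
each with law `N(0, 1/2)`. -/
def stdCN : Measure ℂ :=
  ((gaussianReal 0 (1 / 2)).prod (gaussianReal 0 (1 / 2))).map
    fun z : ℝ × ℝ => (⟨z.1, z.2⟩ : ℂ)

/-- The deterministic parameters of an uplink cell-free system with `M` access points of `N`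
antennas each and `K` single-antenna devices. -/
structure Params (M N K : ℕ) where
  /-- bandwidth -/
  B : ℝ
  /-- blocklength -/
  L : ℕ
  /-- large-scale fading of the link between an access point and a device -/
  β : Fin M → Fin K → ℝ
  /-- pilot powers -/
  pp : Fin K → ℝ
  /-- payload powers -/
  pd : Fin K → ℝ
  /-- pilot sequences -/
  q : Fin K → Fin K → ℂ
  /-- decoding error probabilities -/
  ε : Fin K → ℝ
  /-- the set of access points that serve a device -/
  serve : Fin K → Finset (Fin M)

/-- The random inputs: small-scale fading, pilot noise and payload noise. -/
structure RandomInputs (M N K : ℕ) (Ω : Type*) where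
  /-- small-scale fading vectors -/
  h : Fin M → Fin K → Ω → Fin N → ℂ
  /-- noise matrices in the training phase -/
  pilotNoise : Fin M → Ω → Matrix (Fin N) (Fin K) ℂ
  /-- noise vectors in the data phase -/
  noise : Fin M → Ω → Fin N → ℂ

namespace RandomInputs

variable {M N K : ℕ} {Ω : Type*}

/-- All scalar entries of the random inputs, as one family. -/
def entries (X : RandomInputs M N K Ω) :
    (Fin M × Fin K × Fin N) ⊕ (Fin M × Fin N × Fin K) ⊕ (Fin M × Fin N) → Ω → ℂ
  | .inl (m, k, n), ω => X.h m k ω n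
  | .inr (.inl (m, n, k)), ω => X.pilotNoise m ω n k
  | .inr (.inr (m, n)), ω => X.noise m ω n

/-- All entries have law `CN(0, 1)` and are mutually independent. -/
def IsStandard [MeasurableSpace Ω] (X : RandomInputs M N K Ω) (P : Measure Ω) : Prop :=
  (∀ i, HasLaw (X.entries i) stdCN P) ∧ iIndepFun X.entries P

end RandomInputs

namespace Params

variable {M N K : ℕ} {Ω : Type*} (S : Params M N K) (X : RandomInputs M N K Ω)

/-- The pilots are orthonormal. -/
def OrthonormalPilots : Prop :=
  ∀ k k', star (S.q k) ⬝ᵥ S.q k' = if k = k' then 1 else 0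

/-- The fraction `η = K / L` of the block that is spent on pilots. -/
def η : ℝ := (K : ℝ) / S.L

/-- The channel vector `g_{m,k} = √β_{m,k} h_{m,k}`. -/
def g (m : Fin M) (k : Fin K) (ω : Ω) : Fin N → ℂ :=
  ((√(S.β m k) : ℝ) : ℂ) • X.h m k ω

/-- The pilot signal received at access point `m`. -/
def receivedPilot (m : Fin M) (ω : Ω) : Matrix (Fin N) (Fin K) ℂ :=
  ∑ k, ((√(K * S.pp k) : ℝ) : ℂ) • Matrix.vecMulVec (S.g X m k ω) (star (S.q k))
    + X.pilotNoise m ω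

/-- The pilot signal after correlation with the pilot of device `k`. -/
def yHat (m : Fin M) (k : Fin K) (ω : Ω) : Fin N → ℂ :=
  ((1 / √(K * S.pp k) : ℝ) : ℂ) • (S.receivedPilot X m ω *ᵥ S.q k)

/-- The MMSE estimate of the channel vector. -/
def gHat (m : Fin M) (k : Fin K) (ω : Ω) : Fin N → ℂ :=
  ((K * S.pp k * S.β m k / (K * S.pp k * S.β m k + 1) : ℝ) : ℂ) • S.yHat X m k ω

/-- The variance `λ_{m,k}` of the entries of the channel estimate. -/
def lam (m : Fin M) (k : Fin K) : ℝ :=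
  K * S.pp k * S.β m k ^ 2 / (K * S.pp k * S.β m k + 1)

/-- The estimated channel matrix at access point `m`; its columns are the estimates. -/
def GHat (m : Fin M) (ω : Ω) : Matrix (Fin N) (Fin K) ℂ :=
  Matrix.of fun n k => S.gHat X m k ω n

/-- The unnormalized zero-forcing vector `Ĝ (Ĝᴴ Ĝ)⁻¹ e_k`. -/
def zfVec (m : Fin M) (k : Fin K) (ω : Ω) : Fin N → ℂ :=
  (S.GHat X m ω * ((S.GHat X m ω)ᴴ * S.GHat X m ω)⁻¹) *ᵥ Pi.single k 1

/-- The instantaneous finite-blocklength rate of device `k` at SINR `γ`, with channel dispersion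
`1 - (1 + γ)⁻²`. -/
def fblRate (k : Fin K) (γ : ℝ) : ℝ :=
  S.B * ((1 - S.η) * Real.logb 2 (1 + γ)
    - √((1 - S.η) * (1 - ((1 + γ) ^ 2)⁻¹) / S.L) * (Qinv (S.ε k) / Real.log 2))

/-- The coefficient `Q⁻¹(ε_k) / √(L (1 - η))`. -/
def α (k : Fin K) : ℝ := Qinv (S.ε k) / √(S.L * (1 - S.η))

/-- `f_k(x) = ln (1 + 1/x) - α_k √((2x + 1) / (x + 1)²)`. -/
def f (k : Fin K) (x : ℝ) : ℝ :=
  Real.log (1 + 1 / x) - S.α k * √((2 * x + 1) / (x + 1) ^ 2)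

/-- The closed-form SINR of the zero-forcing decoder. -/
def gammaFZF (k : Fin K) : ℝ :=
  S.pd k * ((N : ℝ) - K) * (∑ m ∈ S.serve k, √(S.lam m k)) ^ 2
    / ((S.serve k).card + ∑ k', S.pd k' * ∑ m ∈ S.serve k, (S.β m k' - S.lam m k'))

variable [MeasurableSpace Ω] (P : Measure Ω)

/-- The full-pilot zero-forcing decoding vector. -/
def a (m : Fin M) (k : Fin K) (ω : Ω) : Fin N → ℂ :=
  ((1 / √(∫ ω', ‖WithLp.toLp 2 (S.zfVec X m k ω')‖ ^ 2 ∂P) : ℝ) : ℂ) • S.zfVec X m k ω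

/-- The desired-signal coefficient. -/
def DS (k : Fin K) : ℂ :=
  ∫ ω, ∑ m ∈ S.serve k, (star (S.a X P m k ω) ⬝ᵥ S.g X m k ω) * ((√(S.pd k) : ℝ) : ℂ) ∂P

/-- The leaked-signal coefficient. -/
def LS (k : Fin K) (ω : Ω) : ℂ :=
  ((√(S.pd k) : ℝ) : ℂ) *
    (∑ m ∈ S.serve k, star (S.a X P m k ω) ⬝ᵥ S.g X m k ω
      - ∫ ω', ∑ m ∈ S.serve k, star (S.a X P m k ω') ⬝ᵥ S.g X m k ω' ∂P)

/-- The interference coefficient of device `k'`. -/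
def UI (k k' : Fin K) (ω : Ω) : ℂ :=
  ∑ m ∈ S.serve k, (star (S.a X P m k ω) ⬝ᵥ S.g X m k' ω) * ((√(S.pd k') : ℝ) : ℂ)

/-- The noise term after combining. -/
def Nk (k : Fin K) (ω : Ω) : ℂ :=
  ∑ m ∈ S.serve k, star (S.a X P m k ω) ⬝ᵥ X.noise m ω

/-- The SINR of device `k` with the full-pilot zero-forcing decoder. -/
def sinr (k : Fin K) (ω : Ω) : ℝ :=
  ‖S.DS X P k‖ ^ 2
    / (‖S.LS X P k ω‖ ^ 2 + ∑ k' ∈ Finset.univ.erase k, ‖S.UI X P k k' ω‖ ^ 2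
      + ‖S.Nk X P k ω‖ ^ 2)

/-- The ergodic finite-blocklength rate of device `k`. -/
def ergodicRate (k : Fin K) : ℝ := ∫ ω, S.fblRate k (S.sinr X P k ω) ∂P

end Params

/-- `g(x) = (x + 1) ln (1 + 1/x) / √(2x + 1)`; for `x > 0`, `f_k(x) ≥ 0` exactly when
`α_k ≤ g(x)`. -/
def gFun (x : ℝ) : ℝ := (x + 1) * Real.log (1 + 1 / x) / √(2 * x + 1)

end

end CellFree

/-! With `x` the inverse SINR, the rate is a positive multiple of `f_k(x)`, so the claim is a Jensen
inequality for `f_k`, which need not be convex on all of `(0, ∞)`. At a feasible point `x₀` it still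
has a subgradient valid on the whole half-line (`exists_subgradient_rate`). Put `φ(x) =
√((2x+1)/(x+1)²)`. Then `ln(1 + 1/x) = g(x) φ(x)`, and with `α = t g(x₀)`, `t ∈ [0, 1]`, one has
`f(y) = (1 - t) ln(1 + 1/y) + t φ(y) (g(y) - g(x₀))`. The first term is convex and decreasing; the
second is controlled because `g` is convex and decreasing and `φ` is decreasing. The slope is
nonpositive, so it suffices that `x₀` is feasible and bounds the mean of `x` from above;
realizations of `x` may leave the feasible region.

To compute that mean, rotate fading and despread pilot noise into normalized estimates and
normalized errors. Orthonormality of the rotation makes estimates, errors and payload noise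
independent (`hasLaw_white`). Zero forcing annihilates the other estimated channels almost surely
and gives the own one a deterministic gain. Hence `DS` is deterministic, and `LS` and `UI` contain
estimation errors only (`ae_denominator_eq`). Conditionally on the estimates these are centred
Gaussian combinations, and `E‖a‖² = 1` turns the mean of the denominator into that of the closed
form.

The numerator needs `E‖v‖² ≤ 1/(λ(N - K))`. By Bessel's inequality, `‖v‖²` is at most the inverse
energy of column `k` in directions orthogonal to the other columns (`normSq_zeroForcing_mul_le`).
There are at least `N - K + 1` such directions, chosen independently of column `k`, and the mean
inverse energy of that many standard complex Gaussians is `1/(N - K)`.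

Integrability of the logarithm rests on the payload noise: `x` is bounded below by a multiple of
`|N_k|²`, and `N_k` has a finite moment of order `-1/2` (`lintegral_rpow_neg_half_Nk_lt_top`). -/

namespace CellFree

/-! ### Convexity of the feasibility threshold and subgradients of the rate. -/

section Analysis

/-- The logarithmic term `x ↦ ln (1 + 1/x)` of the rate lies above its tangents. -/
lemma log_one_add_inv_tangent {x y : ℝ} (hx : 0 < x) (hy : 0 < y) :
    Real.log (1 + 1 / x) + -(1 / (x * (x + 1))) * (y - x) ≤ Real.log (1 + 1 / y) := by
  have hx' : 0 < 1 + 1 / x := by positivity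
  have hy' : 0 < 1 + 1 / y := by positivity
  have h := Real.log_le_sub_one_of_pos (div_pos hx' hy')
  rw [Real.log_div hx'.ne' hy'.ne'] at h
  have h2 : (1 + 1 / x) / (1 + 1 / y) - 1 ≤ 1 / (x * (x + 1)) * (y - x) := by
    have e : 1 / (x * (x + 1)) * (y - x) - ((1 + 1 / x) / (1 + 1 / y) - 1)
        = (y - x) ^ 2 / (x * (x + 1) * (y + 1)) := by field_simp; ring
    have : 0 ≤ (y - x) ^ 2 / (x * (x + 1) * (y + 1)) := by positivity
    linarith
  linarith

/-- The function `x ↦ (x + 1) ln (1 + 1/x)` lies above its tangents. -/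
lemma mul_log_one_add_inv_tangent {x y : ℝ} (hx : 0 < x) (hy : 0 < y) :
    (x + 1) * Real.log (1 + 1 / x) + (Real.log (1 + 1 / x) - 1 / x) * (y - x)
      ≤ (y + 1) * Real.log (1 + 1 / y) := by
  have hx' : 0 < 1 + 1 / x := by positivity
  have hy' : 0 < 1 + 1 / y := by positivity
  have h := Real.log_le_sub_one_of_pos (div_pos hx' hy')
  rw [Real.log_div hx'.ne' hy'.ne'] at h
  -- The factor `y + 1` cancels the denominator of the ratio, so the bound `log r ≤ r - 1` becomes
  -- exactly affine in `y`.
  have h2 := mul_le_mul_of_nonneg_left h (by positivity : 0 ≤ y + 1)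
  have e : (y + 1) * ((1 + 1 / x) / (1 + 1 / y) - 1) = y / x - 1 := by field_simp; ring
  have e2 : 1 / x * (y - x) = y / x - 1 := by field_simp
  rw [e] at h2
  linarith

lemma log_one_add_inv_le {x : ℝ} (hx : 0 < x) : Real.log (1 + 1 / x) ≤ 1 / x := by
  have := Real.log_le_sub_one_of_pos (by positivity : 0 < 1 + 1 / x)
  linarith

/-- The function `x ↦ (2x + 1)^(-1/2)` lies above its tangents. -/
lemma inv_sqrt_tangent {x y : ℝ} (hx : 0 < x) (hy : 0 < y) :
    1 / √(2 * x + 1) + -(1 / √(2 * x + 1) ^ 3) * (y - x) ≤ 1 / √(2 * y + 1) := by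
  have hu : 0 < √(2 * x + 1) := by positivity
  have hv : 0 < √(2 * y + 1) := by positivity
  have hu2 : √(2 * x + 1) ^ 2 = 2 * x + 1 := Real.sq_sqrt (by positivity)
  have hv2 : √(2 * y + 1) ^ 2 = 2 * y + 1 := Real.sq_sqrt (by positivity)
  generalize √(2 * x + 1) = u at *
  generalize √(2 * y + 1) = v at *
  have e : y - x = (v ^ 2 - u ^ 2) / 2 := by rw [hu2, hv2]; ring
  rw [e]
  -- In terms of `u` and `v` the gap to the tangent is rational with a double root at `v = u`.
  have e2 : 1 / v - (1 / u + -(1 / u ^ 3) * ((v ^ 2 - u ^ 2) / 2))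
      = (v - u) ^ 2 * (v + 2 * u) / (2 * u ^ 3 * v) := by field_simp; ring
  have : 0 ≤ (v - u) ^ 2 * (v + 2 * u) / (2 * u ^ 3 * v) := by positivity
  linarith

/-- Tangents of nonpositive slope at both points force both functions to decrease, so their
increments have equal sign. This product is the remainder in the product rule, which makes a product
of nonnegative convex decreasing functions convex. -/
lemma sub_mul_sub_nonneg_of_tangents {a b : ℝ → ℝ} {x y s t s' t' : ℝ}
    (hs : s ≤ 0) (ht : t ≤ 0) (hs' : s' ≤ 0) (ht' : t' ≤ 0)
    (ha : a x + s * (y - x) ≤ a y) (hb : b x + t * (y - x) ≤ b y)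
    (ha' : a y + s' * (x - y) ≤ a x) (hb' : b y + t' * (x - y) ≤ b x) :
    0 ≤ (a y - a x) * (b y - b x) := by
  rcases le_total x y with h | h
  · refine mul_nonneg_of_nonpos_of_nonpos ?_ ?_ <;> nlinarith
  · refine mul_nonneg ?_ ?_ <;> nlinarith

/-- The feasibility threshold `g` has a nonpositive subgradient at every point. -/
lemma exists_subgradient_gFun {x : ℝ} (hx : 0 < x) :
    ∃ s ≤ 0, ∀ y, 0 < y → gFun x + s * (y - x) ≤ gFun y := by
  have hlog : 0 ≤ Real.log (1 + 1 / x) := Real.log_nonneg (by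
    have : 0 < 1 / x := by positivity
    linarith)
  have hslope : ∀ z, 0 < z → Real.log (1 + 1 / z) - 1 / z ≤ 0 := fun z hz => by
    linarith [log_one_add_inv_le hz]
  have hslope' : ∀ z : ℝ, 0 < z → -(1 / √(2 * z + 1) ^ 3) ≤ 0 := fun z hz => by
    have : 0 < 1 / √(2 * z + 1) ^ 3 := by positivity
    linarith
  -- The slope is the product rule applied to `(x + 1) ln(1 + 1/x)` and `(2x + 1)^(-1/2)`.
  refine ⟨(x + 1) * Real.log (1 + 1 / x) * -(1 / √(2 * x + 1) ^ 3)
    + 1 / √(2 * x + 1) * (Real.log (1 + 1 / x) - 1 / x), ?_, fun y hy => ?_⟩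
  · have h1 := mul_nonpos_of_nonneg_of_nonpos
      (by positivity : 0 ≤ (x + 1) * Real.log (1 + 1 / x)) (hslope' x hx)
    have h2 := mul_nonpos_of_nonneg_of_nonpos
      (by positivity : 0 ≤ 1 / √(2 * x + 1)) (hslope x hx)
    linarith
  · have ha := mul_log_one_add_inv_tangent hx hy
    have hb := inv_sqrt_tangent hx hy
    have hp := sub_mul_sub_nonneg_of_tangents
      (a := fun z => (z + 1) * Real.log (1 + 1 / z)) (b := fun z => 1 / √(2 * z + 1))
      (hslope x hx) (hslope' x hx) (hslope y hy) (hslope' y hy) ha hb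
      (mul_log_one_add_inv_tangent hy hx) (inv_sqrt_tangent hy hx)
    have h1 := mul_le_mul_of_nonneg_left ha (by positivity : 0 ≤ 1 / √(2 * x + 1))
    have h2 := mul_le_mul_of_nonneg_left hb
      (by positivity : 0 ≤ (x + 1) * Real.log (1 + 1 / x))
    rw [gFun, gFun, div_eq_mul_one_div _ √(2 * x + 1), div_eq_mul_one_div _ √(2 * y + 1)]
    linarith

lemma sqrt_div_sq {x : ℝ} (hx : 0 < x) :
    √((2 * x + 1) / (x + 1) ^ 2) = √(2 * x + 1) / (x + 1) := by
  rw [Real.sqrt_div (by positivity), Real.sqrt_sq (by positivity)]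

lemma sqrt_dispersion_antitone {x y : ℝ} (hx : 0 < x) (hxy : x ≤ y) :
    √((2 * y + 1) / (y + 1) ^ 2) ≤ √((2 * x + 1) / (x + 1) ^ 2) := by
  have hy : 0 < y := hx.trans_le hxy
  refine Real.sqrt_le_sqrt ?_
  rw [div_le_div_iff₀ (by positivity) (by positivity)]
  -- After cross-multiplication the difference of the two sides is `(y - x)(2xy + x + y)`.
  nlinarith [mul_pos hx hy, mul_nonneg (mul_pos hx hy).le (sub_nonneg.2 hxy)]

/-- This factorization writes the rate as `(g - α)` times the dispersion factor, which is why
feasibility is a comparison of `α` with `g`. -/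
lemma log_eq_gFun_mul {x : ℝ} (hx : 0 < x) :
    Real.log (1 + 1 / x) = gFun x * √((2 * x + 1) / (x + 1) ^ 2) := by
  have : 0 < √(2 * x + 1) := by positivity
  rw [sqrt_div_sq hx, gFun]
  field_simp

lemma gFun_pos {x : ℝ} (hx : 0 < x) : 0 < gFun x := by
  have : 0 < Real.log (1 + 1 / x) := Real.log_pos (by
    have : 0 < 1 / x := by positivity
    linarith)
  unfold gFun
  positivity

/-- On the feasible region, `x ↦ ln (1 + 1/x) - α √((2x + 1) / (x + 1)²)` has a nonpositive
subgradient that is valid on the whole half-line `(0, ∞)`. -/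
lemma exists_subgradient_rate {α x : ℝ} (hα : 0 ≤ α) (hx : 0 < x) (hfeas : α ≤ gFun x) :
    ∃ s ≤ 0, ∀ y, 0 < y →
      Real.log (1 + 1 / x) - α * √((2 * x + 1) / (x + 1) ^ 2) + s * (y - x)
        ≤ Real.log (1 + 1 / y) - α * √((2 * y + 1) / (y + 1) ^ 2) := by
  obtain ⟨p, hp, hsub⟩ := exists_subgradient_gFun hx
  have hg := gFun_pos hx
  -- Feasibility says `t ≤ 1`, so the rate is a nonnegative combination of `ln(1 + 1/y)` and
  -- `φ(y)(g(y) - g(x))` with weights `1 - t` and `t`.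
  set t := α / gFun x with ht
  have ht0 : 0 ≤ t := by positivity
  have ht1 : t ≤ 1 := (div_le_one hg).2 hfeas
  have hαt : α = t * gFun x := by rw [ht]; field_simp
  set φ : ℝ → ℝ := fun x => √((2 * x + 1) / (x + 1) ^ 2) with hφ
  have hφ0 : ∀ z, 0 ≤ φ z := fun z => Real.sqrt_nonneg _
  have hl : -(1 / (x * (x + 1))) ≤ 0 := by
    have : 0 < 1 / (x * (x + 1)) := by positivity
    linarith
  refine ⟨(1 - t) * -(1 / (x * (x + 1))) + t * (φ x * p), ?_, fun y hy => ?_⟩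
  · have h1 := mul_nonpos_of_nonneg_of_nonpos (sub_nonneg.2 ht1) hl
    have h2 := mul_nonpos_of_nonneg_of_nonpos ht0
      (mul_nonpos_of_nonneg_of_nonpos (hφ0 x) hp)
    linarith
  · have h1 := mul_le_mul_of_nonneg_left (log_one_add_inv_tangent hx hy) (sub_nonneg.2 ht1)
    have h2 : φ x * p * (y - x) ≤ φ y * (gFun y - gFun x) := by
      have h3 : φ y * (p * (y - x)) ≤ φ y * (gFun y - gFun x) :=
        mul_le_mul_of_nonneg_left (by linarith [hsub y hy]) (hφ0 y)
      refine le_trans ?_ h3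
      -- Replacing `φ y` by `φ x` loses in the right direction on both sides of `x`: the sign of `p
      -- * (y - x)` flips exactly where the comparison of `φ y` with `φ x` does.
      rcases le_total x y with h | h
      · have := sqrt_dispersion_antitone hx h
        have h5 : p * (y - x) ≤ 0 := mul_nonpos_of_nonpos_of_nonneg hp (sub_nonneg.2 h)
        rw [mul_assoc]
        exact mul_le_mul_of_nonpos_right this h5
      · have := sqrt_dispersion_antitone hy h
        have h5 : 0 ≤ p * (y - x) := mul_nonneg_of_nonpos_of_nonpos hp (sub_nonpos.2 h)
        rw [mul_assoc]
        exact mul_le_mul_of_nonneg_right this h5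
    have h4 := mul_le_mul_of_nonneg_left h2 ht0
    have e1 : Real.log (1 + 1 / x) = gFun x * φ x := log_eq_gFun_mul hx
    have e2 : Real.log (1 + 1 / y) = gFun y * φ y := log_eq_gFun_mul hy
    change Real.log (1 + 1 / x) - α * φ x + _ ≤ Real.log (1 + 1 / y) - α * φ y
    rw [hαt]
    rw [e1, e2] at h1 ⊢
    linarith

end Analysis

/-! ### The Gaussian tail function and the sign of its inverse. -/

section GaussianTail

lemma integrable_exp_neg_sq_div_two : Integrable fun t : ℝ => Real.exp (-t ^ 2 / 2) := by
  have := integrable_exp_neg_mul_sq (b := 1 / 2) (by norm_num)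
  refine this.congr (.of_forall fun t => ?_)
  ring_nf

lemma Q_zero : Q 0 = 1 / 2 := by
  have h := integral_gaussian_Ioi (1 / 2)
  have e : ∫ t in Set.Ioi (0 : ℝ), Real.exp (-t ^ 2 / 2) = √(Real.pi / (1 / 2)) / 2 := by
    rw [← h]; congr 1; ext t; ring_nf
  have h2 : Real.pi / (1 / 2) = 2 * Real.pi := by ring
  have h3 : 0 < √(2 * Real.pi) := by positivity
  rw [Q, e, h2]
  field_simp

lemma Q_sub_Q {x y : ℝ} (hxy : x ≤ y) :
    Q x - Q y = 1 / √(2 * Real.pi) * ∫ t in x..y, Real.exp (-t ^ 2 / 2) := by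
  have hi := integrable_exp_neg_sq_div_two
  rw [Q, Q, ← mul_sub, intervalIntegral.integral_of_le hxy, ← Set.Ioc_union_Ioi_eq_Ioi hxy,
    setIntegral_union (Set.Ioc_disjoint_Ioi le_rfl) measurableSet_Ioi hi.integrableOn
      hi.integrableOn]
  ring

lemma strictAnti_Q : StrictAnti Q := fun x y hxy => by
  have h := Q_sub_Q hxy.le
  have h2 : 0 < ∫ t in x..y, Real.exp (-t ^ 2 / 2) :=
    intervalIntegral.intervalIntegral_pos_of_pos
      integrable_exp_neg_sq_div_two.intervalIntegrable (fun t => Real.exp_pos _) hxy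
  have : 0 < 1 / √(2 * Real.pi) * ∫ t in x..y, Real.exp (-t ^ 2 / 2) := by positivity
  linarith

lemma Q_eq_of_nonneg (x : ℝ) (hx : 0 ≤ x) :
    Q x = 1 / 2 - 1 / √(2 * Real.pi) * ∫ t in (0 : ℝ)..x, Real.exp (-t ^ 2 / 2) := by
  rw [← Q_sub_Q hx, Q_zero]; ring

lemma tendsto_Q_atTop : Filter.Tendsto Q Filter.atTop (nhds 0) := by
  have h := intervalIntegral_tendsto_integral_Ioi (0 : ℝ)
    integrable_exp_neg_sq_div_two.integrableOn Filter.tendsto_id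
  have h2 := (h.const_mul (1 / √(2 * Real.pi))).const_sub (1 / 2)
  have e : 1 / 2 - 1 / √(2 * Real.pi) * ∫ t in Set.Ioi (0 : ℝ), Real.exp (-t ^ 2 / 2) = 0 := by
    have := Q_zero
    rw [Q] at this
    linarith
  rw [e] at h2
  refine h2.congr' ?_
  filter_upwards [Filter.eventually_ge_atTop 0] with x hx
  rw [Q_eq_of_nonneg x hx, id]

lemma Qinv_nonneg {ε : ℝ} (h0 : 0 < ε) (h1 : ε ≤ 1 / 2) : 0 ≤ Qinv ε := by
  -- `Function.invFun` has a meaningful value only on the range of `Q`, so a preimage must be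
  -- produced first, here by the intermediate value theorem on `[0, b]`.
  have hex : ∃ x, Q x = ε := by
    obtain ⟨b, hb0, hb⟩ := ((Filter.eventually_ge_atTop 0).and
      (tendsto_Q_atTop.eventually_le_const h0)).exists
    have hc : ContinuousOn Q (Set.Icc 0 b) := by
      have : Continuous fun x => 1 / 2 - 1 / √(2 * Real.pi) *
          ∫ t in (0 : ℝ)..x, Real.exp (-t ^ 2 / 2) :=
        continuous_const.sub (continuous_const.mul (intervalIntegral.continuous_primitive
          (fun _ _ => integrable_exp_neg_sq_div_two.intervalIntegrable) 0))
      exact this.continuousOn.congr fun x hx => Q_eq_of_nonneg x hx.1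
    obtain ⟨x, -, hx⟩ := intermediate_value_Icc' hb0 hc ⟨hb, by rw [Q_zero]; exact h1⟩
    exact ⟨x, hx⟩
  have h := Function.invFun_eq hex
  refine strictAnti_Q.le_iff_ge.1 ?_
  rw [Q_zero]
  exact h.le.trans h1

end GaussianTail

/-! ### The rate as a rescaling of `f_k`. -/

namespace Params

variable {M N K : ℕ} (S : Params M N K)

lemma η_lt_one (hKL : K < S.L) : S.η < 1 := by
  have : (0 : ℝ) < S.L := by exact_mod_cast (Nat.zero_le K).trans_lt hKL
  rw [η, div_lt_one this]
  exact_mod_cast hKL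

lemma α_nonneg (k : Fin K) (hε0 : 0 < S.ε k) (hε : S.ε k ≤ 1 / 2) : 0 ≤ S.α k :=
  div_nonneg (Qinv_nonneg hε0 hε) (Real.sqrt_nonneg _)

/-- The rate at SINR `1/x` is an affine rescaling of `f_k(x)`. -/
lemma fblRate_eq (hKL : K < S.L) (k : Fin K) {x : ℝ} (hx : 0 < x) :
    S.fblRate k (1 / x) = S.B * ((1 - S.η) / Real.log 2) * S.f k x := by
  have hη : 0 < 1 - S.η := sub_pos.2 (S.η_lt_one hKL)
  have hL : (0 : ℝ) < S.L := by exact_mod_cast (Nat.zero_le K).trans_lt hKL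
  have e : 1 - ((1 + 1 / x) ^ 2)⁻¹ = (2 * x + 1) / (x + 1) ^ 2 := by field_simp; ring
  have e2 : √((1 - S.η) * ((2 * x + 1) / (x + 1) ^ 2) / S.L)
      = (1 - S.η) / √(S.L * (1 - S.η)) * √((2 * x + 1) / (x + 1) ^ 2) := by
    rw [mul_div_right_comm, Real.sqrt_mul (by positivity), Real.sqrt_mul hL.le,
      Real.sqrt_div hη.le]
    congr 1
    rw [div_eq_div_iff (by positivity) (by positivity)]
    linear_combination √(S.L : ℝ) * Real.mul_self_sqrt hη.le
  rw [fblRate, e, e2, f, α, Real.logb]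
  ring

/-- A nonpositive subgradient of `f_k` at a feasible point, valid on `(0, ∞)`. -/
lemma exists_subgradient_f (k : Fin K) (hε0 : 0 < S.ε k) (hε : S.ε k ≤ 1 / 2)
    {x : ℝ} (hx : 0 < x) (hfeas : S.α k ≤ gFun x) :
    ∃ s ≤ 0, ∀ y, 0 < y → S.f k x + s * (y - x) ≤ S.f k y :=
  exists_subgradient_rate (S.α_nonneg k hε0 hε) hx hfeas

end Params

/-! ### Unitary invariance of standard complex Gaussian vectors. -/

section ComplexGaussian

lemma measurable_complexMk : Measurable fun z : ℝ × ℝ => (⟨z.1, z.2⟩ : ℂ) :=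
  Complex.measurableEquivRealProd.symm.measurable

instance : IsProbabilityMeasure stdCN :=
  Measure.isProbabilityMeasure_map measurable_complexMk.aemeasurable

-- The dependence on `t` through `‖t‖` alone is what yields invariance under matrices with
-- orthonormal rows.
open Complex in
lemma charFun_stdCN (t : ℂ) : charFun stdCN t = cexp (-(‖t‖ : ℂ) ^ 2 / 4) := by
  rw [charFun_apply, stdCN, integral_map measurable_complexMk.aemeasurable
    (by fun_prop : Measurable _).aestronglyMeasurable]
  have h : ∀ z : ℝ × ℝ, cexp (inner ℝ (⟨z.1, z.2⟩ : ℂ) t * I)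
      = cexp (t.re * z.1 * I) * cexp (t.im * z.2 * I) := fun z => by
    rw [← Complex.exp_add]
    congr 1
    rw [Complex.inner]
    simp
    ring
  simp_rw [h]
  rw [integral_prod_mul (fun x : ℝ => cexp (t.re * x * I)) (fun x : ℝ => cexp (t.im * x * I)),
    ← charFun_apply_real, ← charFun_apply_real, charFun_gaussianReal, charFun_gaussianReal,
    ← Complex.exp_add]
  congr 1
  have hn : (‖t‖ : ℂ) ^ 2 = t.re * t.re + t.im * t.im := by
    rw [← Complex.ofReal_pow, ← Complex.normSq_eq_norm_sq, Complex.normSq_apply]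
    push_cast
    ring
  rw [hn]
  push_cast
  ring

/-- A matrix with orthonormal rows maps a standard complex Gaussian vector to one. -/
lemma map_pi_stdCN_of_orthonormal_rows {ι κ : Type*} [Fintype ι] [Fintype κ] [DecidableEq κ]
    (A : κ → ι → ℂ) (hA : ∀ j j', ∑ i, A j i * star (A j' i) = if j = j' then 1 else 0) :
    MeasurePreserving (fun (z : ι → ℂ) j => ∑ i, A j i * z i)
      (Measure.pi fun _ => stdCN) (Measure.pi fun _ => stdCN) := by
  have hmeas : Measurable (fun (z : ι → ℂ) j => ∑ i, A j i * z i) := by fun_prop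
  have : IsProbabilityMeasure ((Measure.pi fun _ : ι => stdCN).map
      (fun (z : ι → ℂ) j => ∑ i, A j i * z i)) :=
    Measure.isProbabilityMeasure_map hmeas.aemeasurable
  refine ⟨hmeas, charFun_eq_pi_iff.1 fun t => ?_⟩
  -- The image under the adjoint `Aᴴ t`: it moves `A` to the other side of the inner product, and `A
  -- Aᴴ = 1` gives `‖s‖ = ‖t‖`.
  set s : EuclideanSpace ℂ ι := WithLp.toLp 2 fun i => ∑ j, star (A j i) * t j with hs
  have h1 : charFun (((Measure.pi fun _ : ι => stdCN).map
      (fun (z : ι → ℂ) j => ∑ i, A j i * z i)).map (WithLp.toLp 2)) t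
      = charFun ((Measure.pi fun _ : ι => stdCN).map (WithLp.toLp 2)) s := by
    rw [charFun_apply, charFun_apply, Measure.map_map (by fun_prop) hmeas,
      integral_map ((by fun_prop : Measurable _).comp hmeas).aemeasurable
        (by fun_prop : Measurable _).aestronglyMeasurable,
      integral_map (by fun_prop) (by fun_prop : Measurable _).aestronglyMeasurable]
    congr 1
    ext z
    congr 3
    simp only [Function.comp, PiLp.inner_apply, hs, Complex.inner, map_sum, map_mul,
      Finset.sum_mul, Finset.mul_sum, Complex.re_sum]
    rw [Finset.sum_comm]
    refine Finset.sum_congr rfl fun i _ => Finset.sum_congr rfl fun j _ => ?_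
    congr 1
    simp only [starRingEnd_apply]
    ring
  have h2 : ∑ i, ‖s i‖ ^ 2 = ∑ j, ‖t j‖ ^ 2 := by
    have : (∑ i, s i * star (s i)) = ∑ j, t j * star (t j) := by
      calc (∑ i, s i * star (s i))
          = ∑ i, ∑ j, ∑ j', (A j' i * star (A j i)) * (t j * star (t j')) := by
            refine Finset.sum_congr rfl fun i _ => ?_
            simp only [hs, star_sum, star_mul', star_star, Finset.sum_mul_sum]
            refine Finset.sum_congr rfl fun j _ => Finset.sum_congr rfl fun j' _ => ?_
            ring
        _ = ∑ j, ∑ j', (∑ i, A j' i * star (A j i)) * (t j * star (t j')) := by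
            rw [Finset.sum_comm]
            refine Finset.sum_congr rfl fun j _ => ?_
            rw [Finset.sum_comm]
            simp only [Finset.sum_mul]
        _ = ∑ j, t j * star (t j) := by
            simp only [hA, ite_mul, one_mul, zero_mul, Finset.sum_ite_eq', Finset.mem_univ, if_true]
    have h3 : ∀ w : ℂ, w * star w = ((‖w‖ ^ 2 : ℝ) : ℂ) := fun w => by
      rw [← starRingEnd_apply, Complex.mul_conj, Complex.normSq_eq_norm_sq]
    simp only [h3] at this
    exact_mod_cast this
  rw [h1, charFun_pi]
  simp only [charFun_stdCN, ← Complex.exp_sum]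
  congr 1
  rw [← Finset.sum_div, ← Finset.sum_div, Finset.sum_neg_distrib, Finset.sum_neg_distrib]
  congr 2
  exact_mod_cast h2

/-- A selection of coordinates of a standard complex Gaussian vector. -/
lemma measurePreserving_reindex_stdCN {ι κ : Type*} [Fintype ι] [Fintype κ] {e : κ → ι}
    (he : Function.Injective e) :
    MeasurePreserving (fun (z : ι → ℂ) j => z (e j))
      (Measure.pi fun _ => stdCN) (Measure.pi fun _ => stdCN) := by
  classical
  have := map_pi_stdCN_of_orthonormal_rows (fun (j : κ) (i : ι) => if i = e j then (1 : ℂ) else 0)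
    (fun j j' => by simp [he.eq_iff, eq_comm])
  simpa using this

/-- Disjoint blocks of coordinates of a standard complex Gaussian vector. -/
lemma measurePreserving_blocks_stdCN {ι κ κ' : Type*} [Fintype ι] [Fintype κ] [Fintype κ']
    {e : κ → ι} {e' : κ' → ι} (he : Function.Injective (Sum.elim e e')) :
    MeasurePreserving (fun (z : ι → ℂ) => ((fun j => z (e j)), (fun j => z (e' j))))
      (Measure.pi fun _ => stdCN)
      ((Measure.pi fun _ => stdCN).prod (Measure.pi fun _ => stdCN)) :=
  (measurePreserving_sumPiEquivProdPi (X := fun _ : κ ⊕ κ' => ℂ) (fun _ => stdCN)).comp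
    (measurePreserving_reindex_stdCN he)

/-- The entries of a standard family jointly form a standard complex Gaussian vector. -/
lemma hasLaw_pi_stdCN {ι Ω : Type*} [Fintype ι] [MeasurableSpace Ω] {P : Measure Ω}
    [IsProbabilityMeasure P] {Z : ι → Ω → ℂ} (hlaw : ∀ i, HasLaw (Z i) stdCN P)
    (hind : iIndepFun Z P) :
    HasLaw (fun ω i => Z i ω) (Measure.pi fun _ => stdCN) P where
  aemeasurable := aemeasurable_pi_lambda _ fun i => (hlaw i).aemeasurable
  map_eq := by
    rw [hind.map_fun_eq_pi_map fun i => (hlaw i).aemeasurable]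
    simp only [(hlaw _).map_eq]

/-- A linear functional of a standard complex Gaussian vector has the law of a multiple of a
standard complex Gaussian. -/
lemma map_inner_pi_stdCN {ι : Type*} [Fintype ι] (c : ι → ℂ) :
    (Measure.pi fun _ : ι => stdCN).map (fun z => ∑ i, c i * z i)
      = stdCN.map fun z => (√(∑ i, ‖c i‖ ^ 2) : ℂ) * z := by
  classical
  set r := √(∑ i, ‖c i‖ ^ 2) with hr
  have hr2 : r ^ 2 = ∑ i, ‖c i‖ ^ 2 := Real.sq_sqrt (by positivity)
  by_cases h0 : r = 0
  · have hc : ∀ i, c i = 0 := by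
      rw [h0] at hr2
      intro i
      have := (Finset.sum_eq_zero_iff_of_nonneg (fun i _ => by positivity)).1
        (hr2.symm.trans (by norm_num)) i (Finset.mem_univ i)
      simpa using this
    simp [hc, h0]
  -- Divided by its norm, the coefficient vector is a single orthonormal row.
  · have hrow := map_pi_stdCN_of_orthonormal_rows (fun (_ : Unit) i => (r : ℂ)⁻¹ * c i)
      (fun _ _ => by
        have h1 : ∀ i, ((r : ℂ)⁻¹ * c i) * star ((r : ℂ)⁻¹ * c i)
            = ((r ^ 2)⁻¹ * ‖c i‖ ^ 2 : ℝ) := fun i => by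
          rw [← starRingEnd_apply, Complex.mul_conj, Complex.normSq_eq_norm_sq]
          simp [mul_pow]
        simp only [h1]
        rw [← Complex.ofReal_sum, ← Finset.mul_sum, ← hr2, inv_mul_cancel₀ (by positivity)]
        simp)
    have hev := measurePreserving_eval (fun _ : Unit => stdCN) ()
    have h2 := (hev.comp hrow)
    conv_rhs => rw [← h2.map_eq, Measure.map_map (by fun_prop) h2.measurable]
    congr 1
    ext z
    have : (r : ℂ) ≠ 0 := by exact_mod_cast h0
    simp only [Function.comp, Finset.mul_sum]
    refine Finset.sum_congr rfl fun i _ => ?_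
    field_simp

lemma lintegral_inner_pi_stdCN {ι : Type*} [Fintype ι] (c : ι → ℂ) {F : ℂ → ENNReal}
    (hF : Measurable F) :
    ∫⁻ z, F (∑ i, c i * z i) ∂(Measure.pi fun _ : ι => stdCN)
      = ∫⁻ z, F ((√(∑ i, ‖c i‖ ^ 2) : ℂ) * z) ∂stdCN := by
  rw [← lintegral_map (g := fun z : ι → ℂ => ∑ i, c i * z i) hF (by fun_prop),
    map_inner_pi_stdCN, lintegral_map hF (by fun_prop)]

end ComplexGaussian

/-! ### Positive, negative and inverse moments of complex Gaussians. -/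

section Moments

lemma integrable_sq_gaussianReal (v : NNReal) : Integrable (fun x : ℝ => x ^ 2) (gaussianReal 0 v) :=
  (memLp_id_gaussianReal (μ := 0) (v := v) 2).integrable_sq

lemma integral_sq_gaussianReal (v : NNReal) : ∫ x, x ^ 2 ∂(gaussianReal 0 v) = v := by
  have h := variance_id_gaussianReal (μ := 0) (v := v)
  rw [variance_eq_integral (by fun_prop)] at h
  simpa using h

lemma integral_id_stdCN : ∫ z, z ∂stdCN = 0 := by
  have hint : Integrable (fun z : ℂ => z) stdCN := by
    rw [stdCN, integrable_map_measure (by fun_prop) measurable_complexMk.aemeasurable]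
    have hid : Integrable (fun x : ℝ => x) (gaussianReal 0 (1 / 2)) :=
      (memLp_id_gaussianReal 1).integrable le_rfl
    have h1 : Integrable (fun z : ℝ × ℝ => ((z.1 : ℂ) + z.2 * Complex.I))
        ((gaussianReal 0 (1 / 2)).prod (gaussianReal 0 (1 / 2))) :=
      (hid.comp_fst _).ofReal.add ((hid.comp_snd _).ofReal.mul_const _)
    refine h1.congr (.of_forall fun z => ?_)
    simp [Complex.ext_iff]
  -- The coefficient `-1` has modulus one, so the law is symmetric and its mean equals its own
  -- negative.
  have h := map_inner_pi_stdCN (fun _ : Unit => (-1 : ℂ))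
  have hneg : stdCN.map (fun z => -z) = stdCN := by
    have hev := measurePreserving_eval (fun _ : Unit => stdCN) ()
    have e : (fun z : Unit → ℂ => ∑ i, (-1 : ℂ) * z i) = (fun z => -z) ∘ Function.eval () := by
      ext z; simp
    rw [e, ← Measure.map_map (by fun_prop) hev.measurable, hev.map_eq] at h
    simpa using h
  have h2 : ∫ z, z ∂stdCN = - ∫ z, z ∂stdCN := by
    conv_lhs => rw [← hneg, integral_map (by fun_prop) (by fun_prop)]
    exact integral_neg _
  exact self_eq_neg.1 h2

lemma lintegral_sq_stdCN : ∫⁻ z, ‖z‖ₑ ^ 2 ∂stdCN = 1 := by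
  rw [stdCN, lintegral_map (by fun_prop) measurable_complexMk]
  have h : ∀ z : ℝ × ℝ, ‖(⟨z.1, z.2⟩ : ℂ)‖ₑ ^ 2 = ENNReal.ofReal (z.1 ^ 2 + z.2 ^ 2) := fun z => by
    rw [← ofReal_norm, ← ENNReal.ofReal_pow (norm_nonneg _),
      ← Complex.normSq_eq_norm_sq, Complex.normSq_apply]
    ring_nf
  have hi1 := (integrable_sq_gaussianReal (1 / 2)).comp_fst (gaussianReal 0 (1 / 2))
  have hi2 := (integrable_sq_gaussianReal (1 / 2)).comp_snd (gaussianReal 0 (1 / 2))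
  simp_rw [h]
  rw [← ofReal_integral_eq_lintegral_ofReal
      (f := fun z : ℝ × ℝ => z.1 ^ 2 + z.2 ^ 2) (hi1.add hi2) (.of_forall fun z => by positivity),
    integral_add hi1 hi2,
    integral_fun_fst (fun x : ℝ => x ^ 2), integral_fun_snd (fun x : ℝ => x ^ 2),
    integral_sq_gaussianReal]
  simp
  norm_num

lemma integral_exp_neg_mul_sq_gaussianReal {t : ℝ} (ht : 0 ≤ t) :
    ∫ x, Real.exp (-t * x ^ 2) ∂(gaussianReal 0 (1 / 2)) = (√(1 + t))⁻¹ := by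
  rw [integral_gaussianReal_eq_integral_smul (by norm_num)]
  have h : ∀ x : ℝ, gaussianPDFReal 0 (1 / 2) x • Real.exp (-t * x ^ 2)
      = (√Real.pi)⁻¹ * Real.exp (-(1 + t) * x ^ 2) := fun x => by
    rw [gaussianPDFReal, smul_eq_mul, mul_assoc, ← Real.exp_add]
    have e1 : 2 * Real.pi * ((1 / 2 : NNReal) : ℝ) = Real.pi := by push_cast; ring
    have e2 : -(x - 0) ^ 2 / (2 * ((1 / 2 : NNReal) : ℝ)) + -t * x ^ 2 = -(1 + t) * x ^ 2 := by
      push_cast; ring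
    rw [e1, e2]
  simp_rw [h]
  rw [integral_const_mul, integral_gaussian, Real.sqrt_div Real.pi_pos.le]
  have : √Real.pi ≠ 0 := by positivity
  field_simp

lemma integral_exp_neg_mul_normSq_stdCN {t : ℝ} (ht : 0 ≤ t) :
    ∫ z, Real.exp (-t * ‖z‖ ^ 2) ∂stdCN = (1 + t)⁻¹ := by
  rw [stdCN, integral_map measurable_complexMk.aemeasurable
    (by fun_prop : Measurable _).aestronglyMeasurable]
  have h : ∀ z : ℝ × ℝ, Real.exp (-t * ‖(⟨z.1, z.2⟩ : ℂ)‖ ^ 2)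
      = Real.exp (-t * z.1 ^ 2) * Real.exp (-t * z.2 ^ 2) := fun z => by
    rw [← Complex.normSq_eq_norm_sq, Complex.normSq_apply, ← Real.exp_add]
    ring_nf
  simp_rw [h]
  rw [integral_prod_mul (fun x : ℝ => Real.exp (-t * x ^ 2)) (fun x : ℝ => Real.exp (-t * x ^ 2)),
    integral_exp_neg_mul_sq_gaussianReal ht, ← mul_inv, Real.mul_self_sqrt (by positivity)]

/-- Writing `1/s` as a Laplace integral lets the inverse norm of a vector factor over its
coordinates. At `s = 0` both sides are `⊤`, so no exceptional set arises later. -/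
lemma lintegral_exp_neg_mul_Ioi {s : ℝ} (hs : 0 ≤ s) :
    ∫⁻ t in Set.Ioi (0 : ℝ), ENNReal.ofReal (Real.exp (-t * s)) = (ENNReal.ofReal s)⁻¹ := by
  rcases hs.eq_or_lt with rfl | hs
  · simp
  · have h1 := integral_exp_mul_Ioi (neg_neg_of_pos hs) 0
    have h2 := integrableOn_exp_mul_Ioi (neg_neg_of_pos hs) 0
    have e : ∀ t : ℝ, Real.exp (-t * s) = Real.exp (-s * t) := fun t => by ring_nf
    simp_rw [e]
    rw [← ofReal_integral_eq_lintegral_ofReal h2 (.of_forall fun t => (Real.exp_pos _).le), h1,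
      ← ENNReal.ofReal_inv_of_pos hs]
    congr 1
    simp

lemma lintegral_inv_one_add_pow {d : ℕ} (hd : 0 < d) :
    ∫⁻ t in Set.Ioi (0 : ℝ), ENNReal.ofReal (((1 + t)⁻¹) ^ (d + 1)) = ENNReal.ofReal (1 / d) := by
  have hd' : (0 : ℝ) < d := by exact_mod_cast hd
  have hderiv : ∀ t ∈ Set.Ici (0 : ℝ), HasDerivAt (fun t : ℝ => -(1 / d) * ((1 + t)⁻¹) ^ d)
      (((1 + t)⁻¹) ^ (d + 1)) t := fun t ht => by
    have ht' : (1 + t) ≠ 0 := by have : (0 : ℝ) ≤ t := ht; positivity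
    have h := (((((hasDerivAt_id t).const_add 1).inv ht').pow d).const_mul (-(1 / (d : ℝ))))
    refine h.congr_deriv ?_
    obtain ⟨e, rfl⟩ : ∃ e, d = e + 1 := ⟨d - 1, by omega⟩
    simp
    field_simp
    ring
  have hpos : ∀ t ∈ Set.Ioi (0 : ℝ), 0 ≤ ((1 + t)⁻¹) ^ (d + 1) := fun t ht => by
    have : (0 : ℝ) < t := ht
    positivity
  have hlim : Filter.Tendsto (fun t : ℝ => -(1 / (d : ℝ)) * ((1 + t)⁻¹) ^ d) Filter.atTop
      (nhds 0) := by
    have h1 : Filter.Tendsto (fun t : ℝ => (1 + t)⁻¹) Filter.atTop (nhds 0) :=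
      tendsto_inv_atTop_zero.comp (Filter.tendsto_atTop_add_const_left _ _ Filter.tendsto_id)
    have h2 := (h1.pow d).const_mul (-(1 / (d : ℝ)))
    simpa [hd.ne'] using h2
  have h1 := integral_Ioi_of_hasDerivAt_of_nonneg' hderiv hpos hlim
  have h2 := integrableOn_Ioi_deriv_of_nonneg' hderiv hpos hlim
  rw [← ofReal_integral_eq_lintegral_ofReal h2
    ((ae_restrict_iff' measurableSet_Ioi).2 (.of_forall hpos)), h1]
  simp

/-- The mean of the inverse squared norm of a standard complex Gaussian vector. -/
lemma lintegral_inv_normSq_pi_stdCN {d : ℕ} (hd : 0 < d) :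
    ∫⁻ z, (ENNReal.ofReal (∑ i, ‖z i‖ ^ 2))⁻¹ ∂(Measure.pi fun _ : Fin (d + 1) => stdCN)
      = ENNReal.ofReal (1 / d) := by
  have h1 : ∀ z : Fin (d + 1) → ℂ, (ENNReal.ofReal (∑ i, ‖z i‖ ^ 2))⁻¹
      = ∫⁻ t in Set.Ioi (0 : ℝ), ENNReal.ofReal (Real.exp (-t * ∑ i, ‖z i‖ ^ 2)) := fun z =>
    (lintegral_exp_neg_mul_Ioi (by positivity)).symm
  simp_rw [h1]
  -- After the swap the inner mean is `(1 + t)^(-(d+1))`, by independence of the `d + 1`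
  -- coordinates.
  rw [lintegral_lintegral_swap (by fun_prop), ← lintegral_inv_one_add_pow hd]
  refine setLIntegral_congr_fun measurableSet_Ioi fun t ht => ?_
  have ht' : 0 ≤ t := (show (0 : ℝ) < t from ht).le
  have h2 : ∀ z : Fin (d + 1) → ℂ, Real.exp (-t * ∑ i, ‖z i‖ ^ 2)
      = ∏ i, Real.exp (-t * ‖z i‖ ^ 2) := fun z => by
    rw [← Real.exp_sum, Finset.mul_sum]
  have hint : Integrable (fun z : Fin (d + 1) → ℂ => Real.exp (-t * ∑ i, ‖z i‖ ^ 2))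
      (Measure.pi fun _ => stdCN) := by
    refine Integrable.of_bound (by fun_prop : Measurable _).aestronglyMeasurable 1
      (.of_forall fun z => ?_)
    rw [Real.norm_of_nonneg (Real.exp_pos _).le, Real.exp_le_one_iff]
    exact mul_nonpos_of_nonpos_of_nonneg (neg_nonpos.2 ht') (by positivity)
  rw [← ofReal_integral_eq_lintegral_ofReal hint (.of_forall fun z => (Real.exp_pos _).le)]
  simp_rw [h2]
  rw [integral_fintype_prod_eq_prod (fun (_ : Fin (d + 1)) (z : ℂ) => Real.exp (-t * ‖z‖ ^ 2))]
  simp only [integral_exp_neg_mul_normSq_stdCN ht', Finset.prod_const, Finset.card_univ,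
    Fintype.card_fin]

lemma rpow_neg_le_rpow_neg {x y : ENNReal} {r : ℝ} (hr : 0 ≤ r) (h : x ≤ y) :
    y ^ (-r) ≤ x ^ (-r) := by
  rw [ENNReal.rpow_neg, ENNReal.rpow_neg]
  exact ENNReal.inv_le_inv.2 (ENNReal.rpow_le_rpow h hr)

/-- A standard complex Gaussian has a finite negative moment. -/
lemma lintegral_rpow_neg_half_stdCN_lt_top :
    ∫⁻ z, ‖z‖ₑ ^ (-(1 / 2) : ℝ) ∂stdCN < ⊤ := by
  rw [stdCN, lintegral_map (by fun_prop) measurable_complexMk]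
  -- The real part alone suffices, since `|x|^(-1/2)` is integrable near zero on the line.
  have h1 : ∀ z : ℝ × ℝ, ‖(⟨z.1, z.2⟩ : ℂ)‖ₑ ^ (-(1 / 2) : ℝ) ≤ ‖z.1‖ₑ ^ (-(1 / 2) : ℝ) := fun z => by
    refine rpow_neg_le_rpow_neg (by norm_num) ?_
    rw [← ofReal_norm, ← ofReal_norm]
    exact ENNReal.ofReal_le_ofReal (Complex.abs_re_le_norm ⟨z.1, z.2⟩)
  refine (lintegral_mono h1).trans_lt ?_
  rw [lintegral_prod _ (by fun_prop)]
  simp only [lintegral_const, measure_univ, mul_one]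
  rw [gaussianReal_of_var_ne_zero _ (by norm_num),
    lintegral_withDensity_eq_lintegral_mul _ (measurable_gaussianPDF _ _) (by fun_prop)]
  -- Near zero the density is at most one; away from zero the negative power is.
  have h2 : ∀ x : ℝ, (gaussianPDF 0 (1 / 2) * fun x : ℝ => ‖x‖ₑ ^ (-(1 / 2) : ℝ)) x
      ≤ gaussianPDF 0 (1 / 2) x
        + (Set.Icc (-1) 1).indicator (fun x : ℝ => ‖x‖ₑ ^ (-(1 / 2) : ℝ)) x := fun x => by
    simp only [Pi.mul_apply]
    by_cases hx : x ∈ Set.Icc (-1 : ℝ) 1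
    · rw [Set.indicator_of_mem hx]
      refine le_add_left ?_
      have : gaussianPDF 0 (1 / 2) x ≤ 1 := by
        rw [gaussianPDF, ENNReal.ofReal_le_one, gaussianPDFReal]
        have hpi : 1 ≤ √(2 * Real.pi * ((1 / 2 : NNReal) : ℝ)) := by
          rw [Real.one_le_sqrt]; push_cast; linarith [Real.pi_gt_three]
        refine mul_le_one₀ (inv_le_one_of_one_le₀ hpi) (Real.exp_pos _).le ?_
        rw [Real.exp_le_one_iff, neg_div, neg_nonpos]
        positivity
      calc _ ≤ 1 * ‖x‖ₑ ^ (-(1 / 2) : ℝ) := by gcongr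
        _ = _ := one_mul _
    · rw [Set.indicator_of_notMem hx, add_zero]
      have : ‖x‖ₑ ^ (-(1 / 2) : ℝ) ≤ 1 := by
        have h1x : (1 : ENNReal) ≤ ‖x‖ₑ := by
          rw [← ofReal_norm, ENNReal.one_le_ofReal, Real.norm_eq_abs]
          by_contra hlt
          exact hx (abs_le.1 (not_le.1 hlt).le)
        calc ‖x‖ₑ ^ (-(1 / 2) : ℝ) ≤ 1 ^ (-(1 / 2) : ℝ) :=
              rpow_neg_le_rpow_neg (by norm_num) h1x
          _ = 1 := ENNReal.one_rpow _
      calc _ ≤ gaussianPDF 0 (1 / 2) x * 1 := by gcongr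
        _ = _ := mul_one _
  refine (lintegral_mono h2).trans_lt ?_
  rw [lintegral_add_left (measurable_gaussianPDF _ _), lintegral_gaussianPDF_eq_one _ (by norm_num),
    lintegral_indicator measurableSet_Icc]
  refine ENNReal.add_lt_top.2 ⟨ENNReal.one_lt_top, ?_⟩
  have hint : IntegrableOn (fun x : ℝ => |x| ^ (-(1 / 2) : ℝ)) (Set.Icc (-1) 1) := by
    have h3 : IntervalIntegrable (fun x : ℝ => |x| ^ (-(1 / 2) : ℝ)) volume 0 1 := by
      refine (intervalIntegral.intervalIntegrable_rpow' (r := -(1 / 2)) (by norm_num)).congr ?_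
      intro x hx
      rw [Set.uIoc_of_le zero_le_one] at hx
      simp [abs_of_pos hx.1]
    have h4 : IntervalIntegrable (fun x : ℝ => |x| ^ (-(1 / 2) : ℝ)) volume (-1) 0 := by
      have := (h3.comp_sub_left 0).symm
      simpa using this
    rw [integrableOn_Icc_iff_integrableOn_Ioc, ← intervalIntegrable_iff_integrableOn_Ioc_of_le
      (by norm_num)]
    exact h4.trans h3
  refine lt_of_eq_of_lt (lintegral_congr_ae ?_) hint.2
  refine ae_restrict_of_ae ?_
  have : ∀ᵐ x : ℝ, x ≠ 0 := by simp [ae_iff]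
  filter_upwards [this] with x hx
  rw [← ofReal_norm, ← ofReal_norm,
    ENNReal.ofReal_rpow_of_pos (norm_pos_iff.2 hx), Real.norm_eq_abs, Real.norm_of_nonneg
      (by positivity)]

end Moments

/-! ### Deterministic geometry of the zero-forcing vector. -/

section ZeroForcing

variable {N K : ℕ}

/-- The zero-forcing vector `G (Gᴴ G)⁻¹ e_k` of a matrix `G`. -/
noncomputable def zeroForcing (G : Matrix (Fin N) (Fin K) ℂ) (k : Fin K) : Fin N → ℂ :=
  (G * (Gᴴ * G)⁻¹) *ᵥ Pi.single k 1

/-- The matrix inverse defaults to zero on singular Gram matrices, so the norm bound below also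
holds there. -/
lemma zeroForcing_of_not_isUnit {G : Matrix (Fin N) (Fin K) ℂ} (h : ¬ IsUnit (Gᴴ * G).det)
    (k : Fin K) : zeroForcing G k = 0 := by
  rw [zeroForcing, Matrix.nonsing_inv_apply_not_isUnit _ h, Matrix.mul_zero, Matrix.zero_mulVec]

lemma star_zeroForcing_dotProduct {G : Matrix (Fin N) (Fin K) ℂ} (h : IsUnit (Gᴴ * G).det)
    (k j : Fin K) : star (zeroForcing G k) ⬝ᵥ G.col j = if j = k then 1 else 0 := by
  have h1 : Gᴴ *ᵥ zeroForcing G k = Pi.single k 1 := by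
    rw [zeroForcing, Matrix.mulVec_mulVec, ← Matrix.mul_assoc, Matrix.mul_nonsing_inv _ h,
      Matrix.one_mulVec]
  have h2 : star (G.col j) ⬝ᵥ zeroForcing G k = (Pi.single k 1 : Fin K → ℂ) j := by
    rw [← h1]; rfl
  have h3 := congrArg star h2
  rw [← Matrix.star_dotProduct_star, star_star] at h3
  rw [h3, Pi.single_apply]
  split_ifs <;> simp

lemma dotProduct_zeroForcing (G : Matrix (Fin N) (Fin K) ℂ) (k : Fin K) (u : Fin N → ℂ) :
    u ⬝ᵥ zeroForcing G k
      = ∑ j, ((Gᴴ * G)⁻¹ *ᵥ Pi.single k 1) j * (u ⬝ᵥ G.col j) := by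
  rw [zeroForcing, ← Matrix.mulVec_mulVec, Matrix.dotProduct_mulVec, dotProduct]
  refine Finset.sum_congr rfl fun j _ => ?_
  rw [mul_comm]; rfl

lemma norm_sq_toLp (v : Fin N → ℂ) : ((‖WithLp.toLp 2 v‖ ^ 2 : ℝ) : ℂ) = star v ⬝ᵥ v := by
  rw [EuclideanSpace.norm_sq_eq, Complex.ofReal_sum]
  refine Finset.sum_congr rfl fun i _ => ?_
  rw [Pi.star_apply, mul_comm, ← starRingEnd_apply, Complex.mul_conj, Complex.normSq_eq_norm_sq]

/-- The squared norm of the zero-forcing vector is at most the inverse of the energy of the `k`-th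
column in directions that are orthogonal to the other columns. -/
lemma normSq_zeroForcing_mul_le {G : Matrix (Fin N) (Fin K) ℂ} {k : Fin K} {r : ℕ}
    {u : Fin r → EuclideanSpace ℂ (Fin N)} (hu : Orthonormal ℂ u)
    (hperp : ∀ i j, j ≠ k → inner ℂ (u i) (WithLp.toLp 2 (G.col j)) = 0) :
    ‖WithLp.toLp 2 (zeroForcing G k)‖ ^ 2
      * ∑ i, ‖inner ℂ (u i) (WithLp.toLp 2 (G.col k))‖ ^ 2 ≤ 1 := by
  by_cases h : IsUnit (Gᴴ * G).det
  swap
  · simp [zeroForcing_of_not_isUnit h]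
  set v := WithLp.toLp 2 (zeroForcing G k) with hv
  set c := ((Gᴴ * G)⁻¹ *ᵥ Pi.single k 1) with hc
  have hinner : ∀ x y : EuclideanSpace ℂ (Fin N), inner ℂ x y = star x.ofLp ⬝ᵥ y.ofLp := fun x y => by
    rw [EuclideanSpace.inner_eq_star_dotProduct, dotProduct_comm]
  -- Expand one copy of `v` in the columns of `G`; its inner product with column `j` is `1` for `j =
  -- k` and `0` otherwise.
  have hck : c k = ((‖v‖ ^ 2 : ℝ) : ℂ) := by
    rw [hv, norm_sq_toLp, dotProduct_zeroForcing]
    simp [star_zeroForcing_dotProduct h, hc]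
  have huv : ∀ i, inner ℂ (u i) v = c k * inner ℂ (u i) (WithLp.toLp 2 (G.col k)) := fun i => by
    rw [hinner, hv, dotProduct_zeroForcing, Finset.sum_eq_single k]
    · rw [hinner]
    · intro j _ hj
      have := hperp i j hj
      rw [hinner] at this
      rw [this, mul_zero]
    · simp
  -- Bessel's inequality reads `‖v‖⁴ · energy ≤ ‖v‖²`; one factor `‖v‖²` cancels unless `v = 0`.
  have hb := hu.sum_inner_products_le v (s := Finset.univ)
  simp only [huv, norm_mul, mul_pow, ← Finset.mul_sum] at hb
  rw [hck, Complex.norm_real, Real.norm_of_nonneg (by positivity)] at hb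
  rcases (norm_nonneg v).eq_or_lt with h0 | h0
  · simp [← h0]
  · have h2 : 0 < ‖v‖ ^ 2 := by positivity
    nlinarith

/-- Only the `K - 1` columns other than `k` are to be avoided, so the orthogonal complement has
dimension at least `N - K + 1 = d + 1`. The extra direction is what makes the inverse energy
integrable for `d ≥ 1`. -/
lemma exists_orthonormal_perp (H : Fin K → EuclideanSpace ℂ (Fin N)) (k : Fin K) {d : ℕ}
    (hd : K + d = N) :
    ∃ u : Fin (d + 1) → EuclideanSpace ℂ (Fin N), Orthonormal ℂ u ∧
      ∀ i j, j ≠ k → inner ℂ (u i) (H j) = 0 := by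
  classical
  set V := Submodule.span ℂ (H '' {j | j ≠ k}) with hV
  have hVdim : Module.finrank ℂ V + 1 ≤ K := by
    have h1 : Module.finrank ℂ V ≤ (Finset.univ.erase k).card := by
      have e : H '' {j | j ≠ k} = ((Finset.univ.erase k).image H : Finset _) := by
        ext x; simp
      rw [hV, e]
      exact (finrank_span_finset_le_card _).trans Finset.card_image_le
    rw [Finset.card_erase_of_mem (Finset.mem_univ k), Finset.card_univ, Fintype.card_fin] at h1
    have := k.2
    omega
  have hsum := V.finrank_add_finrank_orthogonal
  rw [finrank_euclideanSpace_fin] at hsum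
  have hle : d + 1 ≤ Module.finrank ℂ Vᗮ := by omega
  refine ⟨fun i => (stdOrthonormalBasis ℂ Vᗮ (Fin.castLE hle i) : EuclideanSpace ℂ (Fin N)),
    ?_, fun i j hj => ?_⟩
  · exact ((stdOrthonormalBasis ℂ Vᗮ).orthonormal.comp _ (Fin.castLE_injective hle)).comp_linearIsometry
      Vᗮ.subtypeₗᵢ
  · have hmem : H j ∈ V := Submodule.subset_span ⟨j, hj, rfl⟩
    exact Submodule.inner_left_of_mem_orthogonal hmem (Subtype.property _)

lemma isUnit_gram_det_of_linearIndependent {G : Matrix (Fin N) (Fin K) ℂ}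
    (h : LinearIndependent ℂ G.col) : IsUnit (Gᴴ * G).det := by
  rw [← Matrix.isUnit_iff_isUnit_det, ← Matrix.mulVec_injective_iff_isUnit]
  have h1 : Function.Injective G.mulVec := Matrix.mulVec_injective_iff.2 h
  intro x y hxy
  have h2 : (Gᴴ * G) *ᵥ (x - y) = 0 := by
    rw [Matrix.mulVec_sub]; exact sub_eq_zero.2 hxy
  have h3 : G *ᵥ (x - y) = 0 := by
    open ComplexOrder in exact (Matrix.conjTranspose_mul_self_mulVec_eq_zero G _).1 h2
  rw [Matrix.mulVec_sub] at h3
  exact h1 (sub_eq_zero.1 h3)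

end ZeroForcing

/-! ### Gaussian matrices: mean norm of zero forcing and almost sure full rank. -/

section GaussianMatrix

variable {N K : ℕ}

/-- The matrix with columns `s_k z_k`. -/
noncomputable def scaledMatrix (s : Fin K → ℝ) (z : Fin K × Fin N → ℂ) :
    Matrix (Fin N) (Fin K) ℂ :=
  Matrix.of fun n k => (s k : ℂ) * z (k, n)

lemma continuous_scaledMatrix (s : Fin K → ℝ) :
    Continuous (scaledMatrix s : (Fin K × Fin N → ℂ) → Matrix (Fin N) (Fin K) ℂ) := by
  refine continuous_matrix fun n k => ?_
  simp only [scaledMatrix, Matrix.of_apply]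
  fun_prop

/-- By the adjugate formula, everything except the scalar `det⁻¹` is continuous in the entries, and
scalar inversion is measurable. -/
lemma measurable_zeroForcing_scaledMatrix (s : Fin K → ℝ) (k : Fin K) :
    Measurable fun z : Fin K × Fin N → ℂ => zeroForcing (scaledMatrix s z) k := by
  have hG := continuous_scaledMatrix (N := N) s
  have e : (fun z : Fin K × Fin N → ℂ => zeroForcing (scaledMatrix s z) k)
      = fun z => (((scaledMatrix s z)ᴴ * scaledMatrix s z).det)⁻¹ •
        ((scaledMatrix s z * ((scaledMatrix s z)ᴴ * scaledMatrix s z).adjugate) *ᵥ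
          Pi.single k 1) := by
    ext1 z
    rw [zeroForcing, Matrix.inv_def, Ring.inverse_eq_inv', Matrix.mul_smul, Matrix.smul_mulVec]
  rw [e]
  have hW : Continuous fun z : Fin K × Fin N → ℂ => (scaledMatrix s z)ᴴ * scaledMatrix s z :=
    hG.matrix_conjTranspose.matrix_mul hG
  exact (hW.matrix_det.measurable.inv).smul
    ((hG.matrix_mul hW.matrix_adjugate).matrix_mulVec continuous_const).measurable

/-- Overwrite the `k`-th block of coordinates. -/
def joinBlocks (k : Fin K) (x : Fin N → ℂ) (y : {j : Fin K // j ≠ k} × Fin N → ℂ) :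
    Fin K × Fin N → ℂ :=
  fun p => if h : p.1 = k then x p.2 else y (⟨p.1, h⟩, p.2)

lemma measurable_joinBlocks (k : Fin K) :
    Measurable fun p : (Fin N → ℂ) × ({j : Fin K // j ≠ k} × Fin N → ℂ) =>
      joinBlocks k p.1 p.2 := by
  refine measurable_pi_lambda _ fun q => ?_
  by_cases h : q.1 = k
  · simp only [joinBlocks, h, dite_true]
    fun_prop
  · simp only [joinBlocks, h, dite_false]
    fun_prop

lemma measurePreserving_splitBlocks (k : Fin K) :
    MeasurePreserving (fun z : Fin K × Fin N → ℂ =>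
        ((fun n => z (k, n)), fun p : {j : Fin K // j ≠ k} × Fin N => z (p.1, p.2)))
      (Measure.pi fun _ => stdCN)
      ((Measure.pi fun _ => stdCN).prod (Measure.pi fun _ => stdCN)) := by
  refine measurePreserving_blocks_stdCN (e := fun n : Fin N => (k, n))
    (e' := fun p : {j : Fin K // j ≠ k} × Fin N => ((p.1 : Fin K), p.2)) ?_
  refine Function.Injective.sumElim (fun a b h => by simpa using h)
    (fun a b h => ?_) (fun a b h => ?_)
  · rw [Prod.mk.injEq] at h
    exact Prod.ext (Subtype.ext h.1) h.2
  · rw [Prod.mk.injEq] at h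
    exact b.1.2 h.1.symm

lemma joinBlocks_split (k : Fin K) (z : Fin K × Fin N → ℂ) :
    joinBlocks k (fun n => z (k, n)) (fun p : {j : Fin K // j ≠ k} × Fin N => z (p.1, p.2)) = z := by
  ext ⟨j, n⟩
  by_cases h : j = k
  · simp [joinBlocks, h]
  · simp [joinBlocks, h]

/-- Fubini's theorem in the form of conditioning on all columns but the `k`-th. -/
lemma lintegral_split_blocks (k : Fin K) {F : (Fin K × Fin N → ℂ) → ENNReal} (hF : Measurable F) :
    ∫⁻ z, F z ∂(Measure.pi fun _ => stdCN)
      = ∫⁻ y, ∫⁻ x, F (joinBlocks k x y) ∂(Measure.pi fun _ => stdCN)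
        ∂(Measure.pi fun _ => stdCN) := by
  have h := (measurePreserving_splitBlocks (N := N) k).lintegral_comp
    (hF.comp (measurable_joinBlocks k))
  simp only [Function.comp, joinBlocks_split] at h
  rw [h]
  exact lintegral_prod_symm _ (hF.comp (measurable_joinBlocks k)).aemeasurable

/-- The coordinates of a standard complex Gaussian vector in orthonormal directions. -/
lemma measurePreserving_inner_orthonormal {r : ℕ} {u : Fin r → EuclideanSpace ℂ (Fin N)}
    (hu : Orthonormal ℂ u) :
    MeasurePreserving (fun (x : Fin N → ℂ) i => inner ℂ (u i) (WithLp.toLp 2 x))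
      (Measure.pi fun _ => stdCN) (Measure.pi fun _ => stdCN) := by
  have h := map_pi_stdCN_of_orthonormal_rows (fun i n => star (u i n)) (fun i j => by
    have h1 := orthonormal_iff_ite.1 hu i j
    rw [EuclideanSpace.inner_eq_star_dotProduct, dotProduct_comm] at h1
    rw [← h1]
    simp [dotProduct])
  convert h using 3 with x i
  rw [EuclideanSpace.inner_eq_star_dotProduct, dotProduct_comm]
  rfl

lemma lintegral_zeroForcing_joinBlocks_le {d : ℕ} (hd : 0 < d) (hN : K + d = N)
    (s : Fin K → ℝ) (k : Fin K) (hs : 0 < s k) (y : {j : Fin K // j ≠ k} × Fin N → ℂ) :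
    ∫⁻ x, ENNReal.ofReal (‖WithLp.toLp 2 (zeroForcing (scaledMatrix s (joinBlocks k x y)) k)‖ ^ 2)
      ∂(Measure.pi fun _ => stdCN) ≤ ENNReal.ofReal (1 / (s k ^ 2 * d)) := by
  -- The directions are built with column `k` set to zero, hence do not depend on the integration
  -- variable `x`; the coordinates of `x` along them are again standard Gaussian.
  obtain ⟨u, hu, hperp⟩ := exists_orthonormal_perp
    (fun j => WithLp.toLp 2 ((scaledMatrix s (joinBlocks k 0 y)).col j)) k hN
  have hcol : ∀ x j, j ≠ k → (scaledMatrix s (joinBlocks k x y)).col j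
      = (scaledMatrix s (joinBlocks k 0 y)).col j := fun x j hj => by
    ext n
    simp [scaledMatrix, joinBlocks, hj]
  have hcolk : ∀ x, (scaledMatrix s (joinBlocks k x y)).col k = (s k : ℂ) • x := fun x => by
    ext n
    simp [scaledMatrix, joinBlocks]
  have hpt : ∀ x : Fin N → ℂ,
      ENNReal.ofReal (‖WithLp.toLp 2 (zeroForcing (scaledMatrix s (joinBlocks k x y)) k)‖ ^ 2)
        ≤ ENNReal.ofReal (1 / s k ^ 2) *
          (ENNReal.ofReal (∑ i, ‖inner ℂ (u i) (WithLp.toLp 2 x)‖ ^ 2))⁻¹ := fun x => by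
    have h := normSq_zeroForcing_mul_le (G := scaledMatrix s (joinBlocks k x y)) (k := k) hu
      (fun i j hj => by rw [hcol x j hj]; exact hperp i j hj)
    rw [hcolk, WithLp.toLp_smul] at h
    simp only [inner_smul_right, norm_mul, mul_pow, ← Finset.mul_sum, Complex.norm_real,
      Real.norm_of_nonneg hs.le] at h
    rcases (by positivity : 0 ≤ ∑ i, ‖inner ℂ (u i) (WithLp.toLp 2 x)‖ ^ 2).eq_or_lt with h0 | h0
    · rw [← h0, ENNReal.ofReal_zero, ENNReal.inv_zero, ENNReal.mul_top]
      · exact le_top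
      · have : 0 < 1 / s k ^ 2 := by positivity
        exact (ENNReal.ofReal_pos.2 this).ne'
    · rw [← ENNReal.ofReal_inv_of_pos h0, ← ENNReal.ofReal_mul (by positivity)]
      refine ENNReal.ofReal_le_ofReal ?_
      have : 0 < s k ^ 2 := by positivity
      rw [one_div, ← mul_inv, ← one_div, le_div_iff₀ (by positivity)]
      exact h
  refine (lintegral_mono hpt).trans ?_
  rw [lintegral_const_mul' _ _ ENNReal.ofReal_ne_top,
    (measurePreserving_inner_orthonormal hu).lintegral_comp
      (f := fun w => (ENNReal.ofReal (∑ i, ‖w i‖ ^ 2))⁻¹) (by fun_prop),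
    lintegral_inv_normSq_pi_stdCN hd, ← ENNReal.ofReal_mul (by positivity)]
  refine ENNReal.ofReal_le_ofReal (le_of_eq ?_)
  field_simp

/-- The mean squared norm of the zero-forcing vector of a Gaussian matrix. -/
lemma lintegral_normSq_zeroForcing_le {d : ℕ} (hd : 0 < d) (hN : K + d = N)
    (s : Fin K → ℝ) (k : Fin K) (hs : 0 < s k) :
    ∫⁻ z : Fin K × Fin N → ℂ,
      ENNReal.ofReal (‖WithLp.toLp 2 (zeroForcing (scaledMatrix s z) k)‖ ^ 2)
        ∂(Measure.pi fun _ => stdCN) ≤ ENNReal.ofReal (1 / (s k ^ 2 * d)) := by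
  have hmeas : Measurable fun z : Fin K × Fin N → ℂ =>
      ENNReal.ofReal (‖WithLp.toLp 2 (zeroForcing (scaledMatrix s z) k)‖ ^ 2) := by
    have := measurable_zeroForcing_scaledMatrix (N := N) s k
    fun_prop
  rw [lintegral_split_blocks k hmeas]
  calc _ ≤ ∫⁻ _, ENNReal.ofReal (1 / (s k ^ 2 * d))
        ∂(Measure.pi fun _ : {j : Fin K // j ≠ k} × Fin N => stdCN) :=
        lintegral_mono fun y => lintegral_zeroForcing_joinBlocks_le hd hN s k hs y
    _ = _ := by simp

/-- A Gaussian column almost surely avoids the span of fewer than `N` fixed vectors. -/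
lemma ae_notMem_span {d : ℕ} (hd : 0 < d) (hN : K + d = N) (H : Fin K → Fin N → ℂ) (k : Fin K)
    {s : ℝ} (hs : 0 < s) {t : Set (Fin K)} (ht : k ∉ t) :
    ∀ᵐ x ∂(Measure.pi fun _ : Fin N => stdCN), (s : ℂ) • x ∉ Submodule.span ℂ (H '' t) := by
  obtain ⟨u, hu, hperp⟩ := exists_orthonormal_perp (fun j => WithLp.toLp 2 (H j)) k hN
  -- A finite mean inverse energy makes the energy in the orthogonal directions nonzero almost
  -- surely, whereas a vector in the span would have energy zero.
  have hlt : ∀ᵐ x ∂(Measure.pi fun _ : Fin N => stdCN),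
      (ENNReal.ofReal (∑ i, ‖inner ℂ (u i) (WithLp.toLp 2 x)‖ ^ 2))⁻¹ < ⊤ := by
    refine ae_lt_top (by fun_prop) ?_
    rw [(measurePreserving_inner_orthonormal hu).lintegral_comp
      (f := fun w => (ENNReal.ofReal (∑ i, ‖w i‖ ^ 2))⁻¹) (by fun_prop),
      lintegral_inv_normSq_pi_stdCN hd]
    exact ENNReal.ofReal_ne_top
  filter_upwards [hlt] with x hx hmem
  have hzero : ∀ w ∈ Submodule.span ℂ (H '' t), ∀ i, inner ℂ (u i) (WithLp.toLp 2 w) = 0 := by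
    intro w hw i
    induction hw using Submodule.span_induction with
    | mem w h =>
      obtain ⟨j, hj, rfl⟩ := h
      exact hperp i j fun e => ht (e ▸ hj)
    | zero => simp
    | add a b _ _ ha hb => rw [WithLp.toLp_add, inner_add_right, ha, hb, add_zero]
    | smul c a _ ha => rw [WithLp.toLp_smul, inner_smul_right, ha, mul_zero]
  have h2 : ∀ i, inner ℂ (u i) (WithLp.toLp 2 x) = 0 := fun i => by
    have := hzero _ hmem i
    rw [WithLp.toLp_smul, inner_smul_right] at this
    have hs' : (s : ℂ) ≠ 0 := by exact_mod_cast hs.ne'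
    exact (mul_eq_zero.1 this).resolve_left hs'
  simp [h2] at hx

lemma measurableSet_linearIndepOn (s : Fin K → ℝ) (t : Set (Fin K)) :
    MeasurableSet {z : Fin K × Fin N → ℂ | LinearIndepOn ℂ (scaledMatrix s z).col t} := by
  have h : IsOpen {f : t → Fin N → ℂ | LinearIndependent ℂ f} :=
    isOpen_setOfPred_linearIndependent
  have hc : Continuous fun (z : Fin K × Fin N → ℂ) (j : t) => (scaledMatrix s z).col j := by
    refine continuous_pi fun j => continuous_pi fun n => ?_
    simp only [scaledMatrix, Matrix.col_apply, Matrix.of_apply]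
    fun_prop
  exact (h.preimage hc).measurableSet

/-- The columns of a Gaussian matrix are almost surely linearly independent. -/
lemma ae_linearIndependent {d : ℕ} (hd : 0 < d) (hN : K + d = N) (s : Fin K → ℝ)
    (hs : ∀ k, 0 < s k) :
    ∀ᵐ z ∂(Measure.pi fun _ : Fin K × Fin N => stdCN),
      LinearIndependent ℂ (scaledMatrix s z).col := by
  suffices h : ∀ t : Finset (Fin K), ∀ᵐ z ∂(Measure.pi fun _ : Fin K × Fin N => stdCN),
      LinearIndepOn ℂ (scaledMatrix s z).col (t : Set (Fin K)) by
    filter_upwards [h Finset.univ] with z hz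
    rw [Finset.coe_univ] at hz
    exact linearIndepOn_univ_iff.1 hz
  intro t
  induction t using Finset.induction_on with
  | empty => exact .of_forall fun z => by simp
  | insert k t hk ih =>
    have hset := measurableSet_linearIndepOn (N := N) s ((insert k t : Finset (Fin K)) : Set (Fin K))
    have hk' : k ∉ (t : Set (Fin K)) := by simpa using hk
    have hcol : ∀ x y j, j ∈ (t : Set (Fin K)) → (scaledMatrix s (joinBlocks k x y)).col j
        = (scaledMatrix s (joinBlocks (N := N) k 0 y)).col j := fun x y j hj => by
      have : j ≠ k := fun e => hk' (e ▸ hj)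
      ext n
      simp [scaledMatrix, joinBlocks, this]
    have hcolk : ∀ x y, (scaledMatrix s (joinBlocks (N := N) k x y)).col k = (s k : ℂ) • x :=
      fun x y => by
      ext n
      simp [scaledMatrix, joinBlocks]
    -- Independence of the columns in `t` does not involve column `k`, so the hypothesis transfers
    -- to the law of the remaining columns.
    have ih' : ∀ᵐ y ∂(Measure.pi fun _ : {j : Fin K // j ≠ k} × Fin N => stdCN),
        LinearIndepOn ℂ (scaledMatrix s (joinBlocks (N := N) k 0 y)).col (t : Set (Fin K)) := by
      have hmp : MeasurePreserving (fun (z : Fin K × Fin N → ℂ)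
          (p : {j : Fin K // j ≠ k} × Fin N) => z (p.1, p.2))
          (Measure.pi fun _ => stdCN) (Measure.pi fun _ => stdCN) :=
        measurePreserving_snd.comp (measurePreserving_splitBlocks (N := N) k)
      have hms : MeasurableSet {y : {j : Fin K // j ≠ k} × Fin N → ℂ |
          LinearIndepOn ℂ (scaledMatrix s (joinBlocks (N := N) k 0 y)).col (t : Set (Fin K))} :=
        (measurableSet_linearIndepOn (N := N) s (t : Set (Fin K))).preimage
          ((measurable_joinBlocks k).comp (measurable_const.prodMk measurable_id))
      rw [← hmp.map_eq, ae_map_iff hmp.aemeasurable hms]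
      filter_upwards [ih] with z hz
      refine hz.congr fun j hj => ?_
      conv_lhs => rw [← joinBlocks_split k z]
      exact hcol _ _ j hj
    have hjoin : ∀ᵐ z ∂(Measure.pi fun _ : Fin K × Fin N => stdCN),
        z ∈ {z : Fin K × Fin N → ℂ |
          LinearIndepOn ℂ (scaledMatrix s z).col ((insert k t : Finset (Fin K)) : Set (Fin K))} := by
      rw [ae_iff]
      change (Measure.pi fun _ : Fin K × Fin N => stdCN)
        ({z | LinearIndepOn ℂ (scaledMatrix s z).col ((insert k t : Finset (Fin K)) : Set (Fin K))}ᶜ) = 0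
      -- The exceptional set is null by Fubini: with the other columns fixed, the new one almost
      -- surely avoids their span.
      rw [← lintegral_indicator_one hset.compl,
        lintegral_split_blocks k (measurable_one.indicator hset.compl)]
      refine lintegral_eq_zero_of_ae_eq_zero ?_
      filter_upwards [ih'] with y hy
      refine lintegral_eq_zero_of_ae_eq_zero ?_
      filter_upwards [ae_notMem_span hd hN (scaledMatrix s (joinBlocks k 0 y)).col k (hs k) hk']
        with x hx
      refine Set.indicator_of_notMem (Set.notMem_compl_iff.2 ?_) _
      change LinearIndepOn ℂ _ _
      rw [Finset.coe_insert, linearIndepOn_insert hk']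
      refine ⟨hy.congr fun j hj => (hcol x y j hj).symm, ?_⟩
      rw [hcolk, Set.image_congr (hcol x y)]
      exact hx
    exact hjoin

end GaussianMatrix

/-! ### Gaussian combinations with independent random coefficients. -/

section RandomCombination

variable {Ω 𝓧 ι : Type*} [MeasurableSpace Ω] [MeasurableSpace 𝓧] [Fintype ι] {P : Measure Ω}
  {ν : Measure 𝓧} {X : Ω → 𝓧} {Y : Ω → ι → ℂ} {Φ : 𝓧 → ι → ℂ}

/-- Given `X`, the combination is a complex Gaussian whose standard deviation is the norm of `Φ (X
ω)`; all moment formulas below are instances. -/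
lemma lintegral_combination
    (hXY : HasLaw (fun ω => (X ω, Y ω)) (ν.prod (Measure.pi fun _ => stdCN)) P)
    (hΦ : Measurable Φ) {F : ℂ → ENNReal} (hF : Measurable F) :
    ∫⁻ ω, F (∑ i, Φ (X ω) i * Y ω i) ∂P
      = ∫⁻ x, ∫⁻ z, F ((√(∑ i, ‖Φ x i‖ ^ 2) : ℂ) * z) ∂stdCN ∂ν := by
  have hm : Measurable fun p : 𝓧 × (ι → ℂ) => F (∑ i, Φ p.1 i * p.2 i) := by fun_prop
  rw [hXY.lintegral_comp (f := fun p : 𝓧 × (ι → ℂ) => F (∑ i, Φ p.1 i * p.2 i)) hm.aemeasurable,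
    lintegral_prod _ hm.aemeasurable]
  exact lintegral_congr fun x => lintegral_inner_pi_stdCN (Φ x) hF

lemma hasLaw_fst_of_prod {𝓨 : Type*} [MeasurableSpace 𝓨] {ρ : Measure 𝓨} [IsProbabilityMeasure ρ]
    {Y : Ω → 𝓨} (hXY : HasLaw (fun ω => (X ω, Y ω)) (ν.prod ρ) P) : HasLaw X ν P :=
  measurePreserving_fst.comp_hasLaw hXY

/-- The second moment of a Gaussian combination with independent random coefficients. -/
lemma lintegral_normSq_combination
    (hXY : HasLaw (fun ω => (X ω, Y ω)) (ν.prod (Measure.pi fun _ => stdCN)) P)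
    (hΦ : Measurable Φ) :
    ∫⁻ ω, ‖∑ i, Φ (X ω) i * Y ω i‖ₑ ^ 2 ∂P
      = ∫⁻ ω, ENNReal.ofReal (∑ i, ‖Φ (X ω) i‖ ^ 2) ∂P := by
  rw [lintegral_combination hXY hΦ (F := fun z => ‖z‖ₑ ^ 2) (by fun_prop),
    (hasLaw_fst_of_prod hXY).lintegral_comp (f := fun x => ENNReal.ofReal (∑ i, ‖Φ x i‖ ^ 2))
      (by fun_prop : Measurable _).aemeasurable]
  refine lintegral_congr fun x => ?_
  simp_rw [enorm_mul, mul_pow]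
  rw [lintegral_const_mul _ (by fun_prop), lintegral_sq_stdCN, mul_one, ← ofReal_norm,
    Complex.norm_real, Real.norm_of_nonneg (Real.sqrt_nonneg _),
    ← ENNReal.ofReal_pow (Real.sqrt_nonneg _), Real.sq_sqrt (by positivity)]

lemma aemeasurable_combination
    (hXY : HasLaw (fun ω => (X ω, Y ω)) (ν.prod (Measure.pi fun _ => stdCN)) P)
    (hΦ : Measurable Φ) : AEMeasurable (fun ω => ∑ i, Φ (X ω) i * Y ω i) P :=
  (by fun_prop : Measurable fun p : 𝓧 × (ι → ℂ) => ∑ i, Φ p.1 i * p.2 i).comp_aemeasurable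
    hXY.aemeasurable

lemma integrable_normSq_combination
    (hXY : HasLaw (fun ω => (X ω, Y ω)) (ν.prod (Measure.pi fun _ => stdCN)) P)
    (hΦ : Measurable Φ) (hint : Integrable (fun ω => ∑ i, ‖Φ (X ω) i‖ ^ 2) P) :
    Integrable (fun ω => ‖∑ i, Φ (X ω) i * Y ω i‖ ^ 2) P ∧
      ∫ ω, ‖∑ i, Φ (X ω) i * Y ω i‖ ^ 2 ∂P = ∫ ω, ∑ i, ‖Φ (X ω) i‖ ^ 2 ∂P := by
  have hm := aemeasurable_combination hXY hΦ
  have h := lintegral_normSq_combination hXY hΦ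
  have e : ∀ ω, ‖∑ i, Φ (X ω) i * Y ω i‖ₑ ^ 2
      = ENNReal.ofReal (‖∑ i, Φ (X ω) i * Y ω i‖ ^ 2) := fun ω => by
    rw [ENNReal.ofReal_pow (norm_nonneg _), ofReal_norm]
  simp_rw [e] at h
  rw [← ofReal_integral_eq_lintegral_ofReal hint (.of_forall fun ω => by positivity)] at h
  have hi : Integrable (fun ω => ‖∑ i, Φ (X ω) i * Y ω i‖ ^ 2) P := by
    refine ⟨(hm.norm.pow_const 2).aestronglyMeasurable, ?_⟩
    rw [hasFiniteIntegral_iff_ofReal (.of_forall fun ω => by positivity), h]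
    exact ENNReal.ofReal_lt_top
  refine ⟨hi, ?_⟩
  rw [← ofReal_integral_eq_lintegral_ofReal hi (.of_forall fun ω => by positivity)] at h
  exact (ENNReal.ofReal_eq_ofReal_iff (integral_nonneg fun ω => by positivity)
    (integral_nonneg fun ω => by positivity)).1 h

/-- A Gaussian combination with independent square integrable coefficients is centred. -/
lemma integral_combination [IsProbabilityMeasure P] [SFinite ν]
    (hXY : HasLaw (fun ω => (X ω, Y ω)) (ν.prod (Measure.pi fun _ => stdCN)) P)
    (hΦ : Measurable Φ) (hint : Integrable (fun ω => ∑ i, ‖Φ (X ω) i‖ ^ 2) P) :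
    Integrable (fun ω => ∑ i, Φ (X ω) i * Y ω i) P ∧ ∫ ω, ∑ i, Φ (X ω) i * Y ω i ∂P = 0 := by
  have hm := aemeasurable_combination hXY hΦ
  have hi : Integrable (fun ω => ∑ i, Φ (X ω) i * Y ω i) P :=
    ((memLp_two_iff_integrable_sq_norm hm.aestronglyMeasurable).2
      (integrable_normSq_combination hXY hΦ hint).1).integrable one_le_two
  refine ⟨hi, ?_⟩
  set f : 𝓧 × (ι → ℂ) → ℂ := fun p => ∑ i, Φ p.1 i * p.2 i with hf
  have hfm : Measurable f := by fun_prop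
  have hfi : Integrable f (ν.prod (Measure.pi fun _ => stdCN)) := by
    rw [← hXY.map_eq, integrable_map_measure hfm.aestronglyMeasurable hXY.aemeasurable]
    exact hi
  have h1 := hXY.integral_comp hfm.aestronglyMeasurable
  refine (show _ = ∫ p, f p ∂_ from h1).trans ?_
  rw [integral_prod _ hfi]
  refine (integral_congr_ae (.of_forall fun x => ?_)).trans (integral_zero _ _)
  have h2 : ∫ z : ι → ℂ, ∑ i, Φ x i * z i ∂(Measure.pi fun _ => stdCN)
      = ∫ w, w ∂((Measure.pi fun _ : ι => stdCN).map fun z => ∑ i, Φ x i * z i) := by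
    rw [integral_map (by fun_prop : Measurable _).aemeasurable (by fun_prop)]
  change ∫ z : ι → ℂ, ∑ i, Φ x i * z i ∂(Measure.pi fun _ => stdCN) = 0
  rw [h2, map_inner_pi_stdCN, integral_map (by fun_prop) (by fun_prop), integral_const_mul,
    integral_id_stdCN, mul_zero]

/-- A negative moment of a Gaussian combination with independent random coefficients. -/
lemma lintegral_rpow_neg_half_combination
    (hXY : HasLaw (fun ω => (X ω, Y ω)) (ν.prod (Measure.pi fun _ => stdCN)) P)
    (hΦ : Measurable Φ) :
    ∫⁻ ω, ‖∑ i, Φ (X ω) i * Y ω i‖ₑ ^ (-(1 / 2) : ℝ) ∂P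
      = (∫⁻ ω, (ENNReal.ofReal √(∑ i, ‖Φ (X ω) i‖ ^ 2)) ^ (-(1 / 2) : ℝ) ∂P)
        * ∫⁻ z, ‖z‖ₑ ^ (-(1 / 2) : ℝ) ∂stdCN := by
  have hm : Measurable fun x => (ENNReal.ofReal √(∑ i, ‖Φ x i‖ ^ 2)) ^ (-(1 / 2) : ℝ) := by
    fun_prop
  rw [lintegral_combination hXY hΦ (F := fun z => ‖z‖ₑ ^ (-(1 / 2) : ℝ)) (by fun_prop),
    (hasLaw_fst_of_prod hXY).lintegral_comp
      (f := fun x => (ENNReal.ofReal √(∑ i, ‖Φ x i‖ ^ 2)) ^ (-(1 / 2) : ℝ)) hm.aemeasurable,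
    ← lintegral_mul_const _ hm]
  refine lintegral_congr fun x => ?_
  rw [← lintegral_const_mul _ (by fun_prop)]
  refine lintegral_congr fun z => ?_
  rw [enorm_mul, ENNReal.mul_rpow_of_ne_top enorm_ne_top enorm_ne_top, ← ofReal_norm
    ((√(∑ i, ‖Φ x i‖ ^ 2) : ℝ) : ℂ), Complex.norm_real, Real.norm_of_nonneg (Real.sqrt_nonneg _)]

end RandomCombination

/-! ### Integrability of the rate and the Jensen step. -/

section Jensen

variable {Ω : Type*} [MeasurableSpace Ω] {P : Measure Ω} [IsProbabilityMeasure P]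

/-- A logarithm is dominated by any positive power; the exponent `1/4` turns `y⁻²` into `y^(-1/2)`,
the available negative moment, and the factor `4` is its reciprocal. -/
lemma log_one_add_le_of_pos {D y : ℝ} (hD : 0 ≤ D) (hy : 0 < y) :
    Real.log (1 + D / y ^ 2) ≤ 4 * (1 + D ^ (1 / 4 : ℝ) * y ^ (-(1 / 2) : ℝ)) := by
  have ht : 0 ≤ D / y ^ 2 := by positivity
  have h1 := Real.log_le_rpow_div (by positivity : 0 ≤ 1 + D / y ^ 2) (by norm_num : (0 : ℝ) < 1 / 4)
  have h2 : (1 + D / y ^ 2) ^ (1 / 4 : ℝ) ≤ 1 ^ (1 / 4 : ℝ) + (D / y ^ 2) ^ (1 / 4 : ℝ) :=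
    Real.rpow_add_le_add_rpow zero_le_one ht (by norm_num) (by norm_num)
  have h3 : (D / y ^ 2) ^ (1 / 4 : ℝ) = D ^ (1 / 4 : ℝ) * y ^ (-(1 / 2) : ℝ) := by
    rw [Real.div_rpow hD (by positivity), Real.rpow_neg hy.le, ← Real.rpow_natCast y 2,
      ← Real.rpow_mul hy.le]
    norm_num [div_eq_mul_inv]
  rw [Real.one_rpow, h3] at h2
  linarith

/-- Integrability of `ln (1 + 1/x)` for `x = y / D` with `y` bounded below by the square of a
variable that has a negative moment. -/
lemma integrable_log_one_add_inv {Z : Ω → ℂ} {x : Ω → ℝ} {D : ℝ} (hD : 0 < D)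
    (hZm : AEMeasurable Z P) (hxm : AEMeasurable x P)
    (hZ : ∫⁻ ω, ‖Z ω‖ₑ ^ (-(1 / 2) : ℝ) ∂P < ⊤)
    (hx : ∀ᵐ ω ∂P, ‖Z ω‖ ^ 2 / D ≤ x ω) :
    (∀ᵐ ω ∂P, 0 < x ω) ∧ Integrable (fun ω => Real.log (1 + 1 / x ω)) P := by
  have hZpos : ∀ᵐ ω ∂P, 0 < ‖Z ω‖ := by
    -- The negative power of zero is `⊤`, so a finite negative moment rules out `Z = 0` almost
    -- surely.
    filter_upwards [ae_lt_top' (by fun_prop) hZ.ne] with ω hω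
    by_contra h
    have h0 : ‖Z ω‖ₑ = 0 := by simpa using h
    rw [h0, ENNReal.zero_rpow_of_neg (by norm_num)] at hω
    exact lt_irrefl _ hω
  have hxpos : ∀ᵐ ω ∂P, 0 < x ω := by
    filter_upwards [hZpos, hx] with ω h1 h2
    exact lt_of_lt_of_le (by positivity) h2
  refine ⟨hxpos, ?_⟩
  have hint : Integrable (fun ω => ‖Z ω‖ ^ (-(1 / 2) : ℝ)) P := by
    refine ⟨(hZm.norm.pow_const _).aestronglyMeasurable, ?_⟩
    rw [hasFiniteIntegral_iff_ofReal (.of_forall fun ω => by positivity)]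
    refine lt_of_eq_of_lt (lintegral_congr_ae ?_) hZ
    filter_upwards [hZpos] with ω h
    rw [← ENNReal.ofReal_rpow_of_pos h, ofReal_norm]
  refine Integrable.mono' (((integrable_const 1).add (hint.const_mul (D ^ (1 / 4 : ℝ)))).const_mul 4)
    (by fun_prop : AEMeasurable _ P).aestronglyMeasurable ?_
  filter_upwards [hZpos, hx, hxpos] with ω h1 h2 h3
  have h4 : 0 ≤ Real.log (1 + 1 / x ω) := Real.log_nonneg (by
    have : 0 < 1 / x ω := by positivity
    linarith)
  rw [Real.norm_of_nonneg h4]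
  refine le_trans (Real.log_le_log (by positivity) ?_) (log_one_add_le_of_pos hD.le h1)
  have h5 : 1 / x ω ≤ 1 / (‖Z ω‖ ^ 2 / D) := one_div_le_one_div_of_le (by positivity) h2
  rw [one_div_div] at h5
  linarith

/-- A Jensen-type lower bound for the mean rate in terms of the mean inverse SINR. -/
lemma Params.integrable_fblRate_and_le {M N K : ℕ} (S : Params M N K) (hB : 0 < S.B)
    (hKL : K < S.L) (k : Fin K) (hε0 : 0 < S.ε k) (hε : S.ε k ≤ 1 / 2) {x₀ : ℝ} (hx₀ : 0 < x₀)
    (hfeas : S.α k ≤ gFun x₀) {x : Ω → ℝ} {γ : Ω → ℝ} (hγ : ∀ᵐ ω ∂P, γ ω = 1 / x ω)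
    (hpos : ∀ᵐ ω ∂P, 0 < x ω) (hint : Integrable x P) (hle : ∫ ω, x ω ∂P ≤ x₀)
    (hlog : Integrable (fun ω => Real.log (1 + 1 / x ω)) P) :
    Integrable (fun ω => S.fblRate k (γ ω)) P ∧
      S.B * ((1 - S.η) / Real.log 2) * S.f k x₀ ≤ ∫ ω, S.fblRate k (γ ω) ∂P := by
  have hη : 0 < 1 - S.η := sub_pos.2 (S.η_lt_one hKL)
  have hc : 0 ≤ S.B * ((1 - S.η) / Real.log 2) := by positivity
  have hrate : ∀ᵐ ω ∂P, S.B * ((1 - S.η) / Real.log 2) * S.f k (x ω) = S.fblRate k (γ ω) := by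
    filter_upwards [hγ, hpos] with ω h1 h2
    rw [h1, S.fblRate_eq hKL k h2]
  have hf : Integrable (fun ω => S.f k (x ω)) P := by
    refine hlog.sub (Integrable.const_mul ?_ _)
    have hxm := hint.aemeasurable
    refine Integrable.of_bound (by fun_prop : AEMeasurable _ P).aestronglyMeasurable 1 ?_
    filter_upwards [hpos] with ω h
    rw [Real.norm_of_nonneg (Real.sqrt_nonneg _), Real.sqrt_le_one, div_le_one (by positivity)]
    nlinarith
  obtain ⟨s, hs, hsub⟩ := S.exists_subgradient_f k hε0 hε hx₀ hfeas
  have hsubint : Integrable (fun ω => s * (x ω - x₀)) P :=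
    (hint.sub (integrable_const _)).const_mul s
  have hlow : S.f k x₀ ≤ ∫ ω, S.f k (x ω) ∂P := by
    have h1 : ∫ ω, (S.f k x₀ + s * (x ω - x₀)) ∂P ≤ ∫ ω, S.f k (x ω) ∂P := by
      refine integral_mono_ae ((integrable_const _).add hsubint) hf ?_
      filter_upwards [hpos] with ω h
      exact hsub _ h
    rw [integral_add (integrable_const _) hsubint,
      integral_const_mul, integral_sub hint (integrable_const _)] at h1
    simp only [integral_const, probReal_univ, one_smul] at h1
    -- The nonpositive slope is what lets an upper bound on the mean replace its exact value.
    have := mul_nonneg_of_nonpos_of_nonpos hs (sub_nonpos.2 hle)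
    linarith
  refine ⟨(hf.const_mul _).congr hrate, ?_⟩
  rw [← integral_congr_ae hrate, integral_const_mul]
  exact mul_le_mul_of_nonneg_left hlow hc

end Jensen

/-! ### Whitening: independent estimates, errors and payload noise. -/

namespace Params

variable {M N K : ℕ} {Ω : Type*} (S : Params M N K) (X : RandomInputs M N K Ω)

/-- The coefficient of the MMSE estimate. -/
noncomputable def mmse (m : Fin M) (k : Fin K) : ℝ :=
  K * S.pp k * S.β m k / (K * S.pp k * S.β m k + 1)

/-- Coefficients that combine the fading `h_{m,k}` with weight `a` and the despread pilot noise with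
weight `b`. -/
def mixRow (a b : ℝ) (m : Fin M) (k : Fin K) (n : Fin N) :
    (Fin M × Fin K × Fin N) ⊕ (Fin M × Fin N × Fin K) ⊕ (Fin M × Fin N) → ℂ
  | .inl (m', k', n') => if m = m' ∧ k = k' ∧ n = n' then a else 0
  | .inr (.inl (m', n', j)) => if m = m' ∧ n = n' then b * S.q k j else 0
  | .inr (.inr _) => 0

/-- Coefficients that select an entry of the payload noise. -/
def noiseRow (m : Fin M) (n : Fin N) :
    (Fin M × Fin K × Fin N) ⊕ (Fin M × Fin N × Fin K) ⊕ (Fin M × Fin N) → ℂ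
  | .inr (.inr p) => if (m, n) = p then 1 else 0
  | _ => 0

/-- The linear map from the random inputs to the normalized channel estimates, the normalized
estimation errors and the payload noise. -/
noncomputable def whitening :
    (Fin M × Fin K × Fin N) ⊕ (Fin M × Fin K × Fin N) ⊕ (Fin M × Fin N) →
    (Fin M × Fin K × Fin N) ⊕ (Fin M × Fin N × Fin K) ⊕ (Fin M × Fin N) → ℂ
  | .inl (m, k, n) => S.mixRow √(S.mmse m k) √(1 - S.mmse m k) m k n
  | .inr (.inl (m, k, n)) => S.mixRow √(1 - S.mmse m k) (-√(S.mmse m k)) m k n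
  | .inr (.inr (m, n)) => noiseRow m n

/-- The normalized estimates, normalized estimation errors and payload noise. -/
noncomputable def white (ω : Ω) :
    (Fin M × Fin K × Fin N) ⊕ (Fin M × Fin K × Fin N) ⊕ (Fin M × Fin N) → ℂ :=
  fun j => ∑ i, S.whitening j i * X.entries i ω

/-- Orthonormal pilots make the despread noises of different devices uncorrelated, so rows interact
only at equal indices, through the planar inner product of `(a, b)` and `(a', b')`. In `whitening`
these pairs form a planar orthonormal basis. -/
lemma sum_mixRow_mul_star (hq : S.OrthonormalPilots) (a b a' b' : ℝ) (m m' : Fin M)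
    (k k' : Fin K) (n n' : Fin N) :
    ∑ i, S.mixRow a b m k n i * star (S.mixRow a' b' m' k' n' i)
      = if (m, k, n) = (m', k', n') then ((a * a' + b * b' : ℝ) : ℂ) else 0 := by
  have hqq : ∑ j, S.q k j * star (S.q k' j) = if k = k' then 1 else 0 := by
    have := hq k' k
    rw [dotProduct_comm, dotProduct] at this
    simp only [Pi.star_apply] at this
    rw [this]
    simp [eq_comm]
  rw [Fintype.sum_sum_type, Fintype.sum_sum_type]
  simp only [mixRow, Fintype.sum_prod_type]
  by_cases hm : m = m'
  · by_cases hn : n = n'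
    · subst hm hn
      have h1 : ∑ x, ∑ x_1, ∑ x_2, (if m = x ∧ n = x_1 then (b : ℂ) * S.q k x_2 else 0)
          * star (if m = x ∧ n = x_1 then (b' : ℂ) * S.q k' x_2 else 0)
          = b * b' * ∑ j, S.q k j * star (S.q k' j) := by
        rw [Finset.sum_eq_single m, Finset.sum_eq_single n, Finset.mul_sum]
        · refine Finset.sum_congr rfl fun j _ => ?_
          simp
          ring
        · intro x _ hx; simp [hx.symm]
        · simp
        · intro x _ hx; simp [hx.symm]
        · simp
      have h2 : ∑ x, ∑ x_1, ∑ x_2, (if m = x ∧ k = x_1 ∧ n = x_2 then (a : ℂ) else 0)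
          * star (if m = x ∧ k' = x_1 ∧ n = x_2 then (a' : ℂ) else 0)
          = if k = k' then (a : ℂ) * a' else 0 := by
        rw [Finset.sum_eq_single m, Finset.sum_eq_single k, Finset.sum_eq_single n]
        · by_cases hk : k = k'
          · simp [hk]
          · simp [hk, Ne.symm hk]
        · intro x _ hx; simp [hx.symm]
        · simp
        · intro x _ hx; simp [hx.symm]
        · simp
        · intro x _ hx; simp [hx.symm]
        · simp
      rw [h1, h2, hqq]
      by_cases hk : k = k' <;> simp [hk]
    · have h1 : ∀ x x_1 x_2, (if m = x ∧ n = x_1 then (b : ℂ) * S.q k x_2 else 0)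
          * star (if m' = x ∧ n' = x_1 then (b' : ℂ) * S.q k' x_2 else 0) = 0 := by
        intro x y z
        by_cases h : n = y
        · have : n' ≠ y := fun e => hn (h.trans e.symm)
          simp [this]
        · simp [h]
      have h2 : ∀ x x_1 x_2, (if m = x ∧ k = x_1 ∧ n = x_2 then (a : ℂ) else 0)
          * star (if m' = x ∧ k' = x_1 ∧ n' = x_2 then (a' : ℂ) else 0) = 0 := by
        intro x y z
        by_cases h : n = z
        · have : n' ≠ z := fun e => hn (h.trans e.symm)
          simp [this]
        · simp [h]
      simp only [h1, h2]
      simp [hn]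
  · have h1 : ∀ x x_1 x_2, (if m = x ∧ n = x_1 then (b : ℂ) * S.q k x_2 else 0)
        * star (if m' = x ∧ n' = x_1 then (b' : ℂ) * S.q k' x_2 else 0) = 0 := by
      intro x y z
      by_cases h : m = x
      · have : m' ≠ x := fun e => hm (h.trans e.symm)
        simp [this]
      · simp [h]
    have h2 : ∀ x x_1 x_2, (if m = x ∧ k = x_1 ∧ n = x_2 then (a : ℂ) else 0)
        * star (if m' = x ∧ k' = x_1 ∧ n' = x_2 then (a' : ℂ) else 0) = 0 := by
      intro x y z
      by_cases h : m = x
      · have : m' ≠ x := fun e => hm (h.trans e.symm)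
        simp [this]
      · simp [h]
    simp only [h1, h2]
    simp [hm]

lemma sum_mixRow_mul_star_noiseRow (a b : ℝ) (m m' : Fin M) (k : Fin K) (n n' : Fin N) :
    ∑ i, S.mixRow a b m k n i * star (noiseRow m' n' i) = 0 := by
  rw [Fintype.sum_sum_type, Fintype.sum_sum_type]
  simp [mixRow, noiseRow]

lemma sum_noiseRow_mul_star_mixRow (a b : ℝ) (m m' : Fin M) (k : Fin K) (n n' : Fin N) :
    ∑ i, noiseRow m' n' i * star (S.mixRow a b m k n i) = 0 := by
  rw [Fintype.sum_sum_type, Fintype.sum_sum_type]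
  simp [mixRow, noiseRow]

lemma sum_noiseRow_mul_star_noiseRow (m m' : Fin M) (n n' : Fin N) :
    ∑ i, noiseRow (K := K) m n i * star (noiseRow m' n' i)
      = if (m, n) = (m', n') then 1 else 0 := by
  rw [Fintype.sum_sum_type, Fintype.sum_sum_type]
  simp [noiseRow, eq_comm]

section Positive

variable {S}

lemma mmse_mem (hβ : ∀ m k, 0 < S.β m k) (hpp : ∀ k, 0 < S.pp k) (m : Fin M) (k : Fin K) :
    0 < S.mmse m k ∧ S.mmse m k < 1 := by
  have hK : (0 : ℝ) < K := by exact_mod_cast (Nat.zero_le _).trans_lt k.2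
  have h1 := hβ m k
  have h2 := hpp k
  have : 0 < K * S.pp k * S.β m k := by positivity
  rw [mmse]
  exact ⟨by positivity, by rw [div_lt_one (by positivity)]; linarith⟩

lemma lam_eq (m : Fin M) (k : Fin K) : S.lam m k = S.mmse m k * S.β m k := by
  rw [lam, mmse]; ring

lemma lam_pos (hβ : ∀ m k, 0 < S.β m k) (hpp : ∀ k, 0 < S.pp k) (m : Fin M) (k : Fin K) :
    0 < S.lam m k := by
  rw [lam_eq]; exact mul_pos (mmse_mem hβ hpp m k).1 (hβ m k)

lemma sub_lam_pos (hβ : ∀ m k, 0 < S.β m k) (hpp : ∀ k, 0 < S.pp k) (m : Fin M) (k : Fin K) :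
    0 < S.β m k - S.lam m k := by
  have h := mul_pos (sub_pos.2 (mmse_mem hβ hpp m k).2) (hβ m k)
  rw [lam_eq]; linarith

lemma whitening_orthonormal (hq : S.OrthonormalPilots) (hβ : ∀ m k, 0 < S.β m k)
    (hpp : ∀ k, 0 < S.pp k)
    (j j' : (Fin M × Fin K × Fin N) ⊕ (Fin M × Fin K × Fin N) ⊕ (Fin M × Fin N)) :
    ∑ i, S.whitening j i * star (S.whitening j' i) = if j = j' then 1 else 0 := by
  have hs : ∀ m k, √(S.mmse m k) * √(S.mmse m k) = S.mmse m k := fun m k =>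
    Real.mul_self_sqrt (mmse_mem hβ hpp m k).1.le
  have hs' : ∀ m k, √(1 - S.mmse m k) * √(1 - S.mmse m k) = 1 - S.mmse m k := fun m k =>
    Real.mul_self_sqrt (sub_pos.2 (mmse_mem hβ hpp m k).2).le
  rcases j with ⟨m, k, n⟩ | ⟨m, k, n⟩ | ⟨m, n⟩ <;> rcases j' with ⟨m', k', n'⟩ | ⟨m', k', n'⟩ | ⟨m', n'⟩
  · simp only [whitening, S.sum_mixRow_mul_star hq, Sum.inl.injEq]
    split_ifs with h
    · obtain ⟨rfl, rfl, rfl⟩ := by simpa using h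
      rw [hs, hs']; simp
    · rfl
  · simp only [whitening, S.sum_mixRow_mul_star hq, reduceCtorEq, if_false]
    split_ifs with h
    · obtain ⟨rfl, rfl, rfl⟩ := by simpa using h
      rw [Complex.ofReal_eq_zero]; ring
    · rfl
  · simp only [whitening, sum_mixRow_mul_star_noiseRow, reduceCtorEq, if_false]
  · simp only [whitening, S.sum_mixRow_mul_star hq, reduceCtorEq, if_false]
    split_ifs with h
    · obtain ⟨rfl, rfl, rfl⟩ := by simpa using h
      rw [Complex.ofReal_eq_zero]; ring
    · rfl
  · simp only [whitening, S.sum_mixRow_mul_star hq, Sum.inl.injEq, Sum.inr.injEq]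
    split_ifs with h
    · obtain ⟨rfl, rfl, rfl⟩ := by simpa using h
      rw [neg_mul_neg, hs, hs']; simp
    · rfl
  · simp only [whitening, sum_mixRow_mul_star_noiseRow, reduceCtorEq, if_false, Sum.inr.injEq]
  · simp only [whitening, sum_noiseRow_mul_star_mixRow, reduceCtorEq, if_false]
  · simp only [whitening, sum_noiseRow_mul_star_mixRow, reduceCtorEq, if_false, Sum.inr.injEq]
  · simp only [whitening, sum_noiseRow_mul_star_noiseRow, Sum.inr.injEq]

/-- The normalized estimates, errors and payload noises are independent `CN(0, 1)`. -/
lemma hasLaw_white [MeasurableSpace Ω] {P : Measure Ω} [IsProbabilityMeasure P]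
    {X : RandomInputs M N K Ω} (hX : X.IsStandard P) (hq : S.OrthonormalPilots)
    (hβ : ∀ m k, 0 < S.β m k) (hpp : ∀ k, 0 < S.pp k) :
    HasLaw (S.white X) (Measure.pi fun _ => stdCN) P :=
  (map_pi_stdCN_of_orthonormal_rows S.whitening (whitening_orthonormal hq hβ hpp)).comp_hasLaw
    (hasLaw_pi_stdCN hX.1 hX.2)

end Positive

lemma sum_mixRow_mul_entries (a b : ℝ) (m : Fin M) (k : Fin K) (n : Fin N) (ω : Ω) :
    ∑ i, S.mixRow a b m k n i * X.entries i ω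
      = a * X.h m k ω n + b * (X.pilotNoise m ω *ᵥ S.q k) n := by
  rw [Fintype.sum_sum_type, Fintype.sum_sum_type]
  simp only [mixRow, RandomInputs.entries, Fintype.sum_prod_type, zero_mul, Finset.sum_const_zero,
    add_zero]
  congr 1
  · rw [Finset.sum_eq_single m, Finset.sum_eq_single k, Finset.sum_eq_single n]
    · simp
    · intro x _ hx; simp [hx.symm]
    · simp
    · intro x _ hx; simp [hx.symm]
    · simp
    · intro x _ hx; simp [hx.symm]
    · simp
  · rw [Finset.sum_eq_single m, Finset.sum_eq_single n, Matrix.mulVec, dotProduct, Finset.mul_sum]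
    · refine Finset.sum_congr rfl fun j _ => ?_
      simp
      ring
    · intro x _ hx; simp [hx.symm]
    · simp
    · intro x _ hx; simp [hx.symm]
    · simp

lemma noise_eq (m : Fin M) (n : Fin N) (ω : Ω) :
    X.noise m ω n = S.white X ω (.inr (.inr (m, n))) := by
  rw [white, Fintype.sum_sum_type, Fintype.sum_sum_type]
  simp [whitening, noiseRow, RandomInputs.entries]

variable {S}

lemma receivedPilot_mulVec (hq : S.OrthonormalPilots) (m : Fin M) (k : Fin K) (ω : Ω) :
    S.receivedPilot X m ω *ᵥ S.q k
      = ((√(K * S.pp k) : ℝ) : ℂ) • S.g X m k ω + X.pilotNoise m ω *ᵥ S.q k := by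
  rw [receivedPilot, Matrix.add_mulVec, Matrix.sum_mulVec]
  congr 1
  rw [Finset.sum_eq_single k]
  · rw [Matrix.smul_mulVec, Matrix.vecMulVec_mulVec, hq k k]
    simp
  · intro k' _ hk
    rw [Matrix.smul_mulVec, Matrix.vecMulVec_mulVec, hq k' k]
    simp [hk]
  · simp

/-- These identities match the coefficients of fading and despread noise in the estimate and in the
error with the rows of the rotation. All follow by squaring. -/
lemma sqrt_lam_mul_sqrt (hβ : ∀ m k, 0 < S.β m k) (hpp : ∀ k, 0 < S.pp k) (m : Fin M) (k : Fin K) :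
    √(S.lam m k) * √(S.mmse m k) = S.mmse m k * √(S.β m k) ∧
    √(S.lam m k) * √(1 - S.mmse m k) = S.mmse m k * (1 / √(K * S.pp k)) ∧
    √(S.β m k - S.lam m k) * √(1 - S.mmse m k) = (1 - S.mmse m k) * √(S.β m k) ∧
    √(S.β m k - S.lam m k) * √(S.mmse m k) = S.mmse m k * (1 / √(K * S.pp k)) := by
  have hK : (0 : ℝ) < K := by exact_mod_cast (Nat.zero_le _).trans_lt k.2
  have h1 := hβ m k
  have h2 := hpp k
  obtain ⟨hc0, hc1⟩ := mmse_mem hβ hpp m k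
  have hc1' : 0 < 1 - S.mmse m k := sub_pos.2 hc1
  have hP : 0 < K * S.pp k := by positivity
  -- Equivalent to `1 - c = 1/(K p β + 1)` for the estimator coefficient `c`; it balances the two
  -- noise contributions.
  have hkey : S.β m k * (1 - S.mmse m k) * (K * S.pp k) = S.mmse m k := by
    rw [mmse]
    have : K * S.pp k * S.β m k + 1 ≠ 0 := by positivity
    field_simp
    ring
  have hb : S.β m k - S.lam m k = (1 - S.mmse m k) * S.β m k := by rw [lam_eq]; ring
  have hsq : ∀ {x y : ℝ}, 0 ≤ x → 0 ≤ y → x ^ 2 = y ^ 2 → x = y := fun hx hy h =>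
    (pow_left_inj₀ hx hy two_ne_zero).1 h
  have hlam := lam_pos hβ hpp m k
  have hsub := sub_lam_pos hβ hpp m k
  refine ⟨hsq (by positivity) (by positivity) ?_, hsq (by positivity) (by positivity) ?_,
    hsq (by positivity) (by positivity) ?_, hsq (by positivity) (by positivity) ?_⟩
  · rw [mul_pow, mul_pow, Real.sq_sqrt hlam.le, Real.sq_sqrt hc0.le, Real.sq_sqrt h1.le, lam_eq]
    ring
  · rw [mul_pow, mul_pow, Real.sq_sqrt hlam.le, Real.sq_sqrt hc1'.le, div_pow, Real.sq_sqrt hP.le,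
      lam_eq]
    field_simp
    linear_combination hkey
  · rw [mul_pow, mul_pow, Real.sq_sqrt hsub.le, Real.sq_sqrt hc1'.le, Real.sq_sqrt h1.le, hb]
    ring
  · rw [mul_pow, mul_pow, Real.sq_sqrt hsub.le, Real.sq_sqrt hc0.le, div_pow, Real.sq_sqrt hP.le,
      hb]
    field_simp
    linear_combination hkey

lemma gHat_apply (hq : S.OrthonormalPilots) (hpp : ∀ k, 0 < S.pp k)
    (m : Fin M) (k : Fin K) (ω : Ω) (n : Fin N) :
    S.gHat X m k ω n = S.mmse m k * √(S.β m k) * X.h m k ω n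
      + (S.mmse m k * (1 / √(K * S.pp k)) : ℝ) * (X.pilotNoise m ω *ᵥ S.q k) n := by
  have hK : (0 : ℝ) < K := by exact_mod_cast (Nat.zero_le _).trans_lt k.2
  have h2 := hpp k
  have hP : ((√(K * S.pp k) : ℝ) : ℂ) ≠ 0 := by
    have : 0 < √(K * S.pp k) := by positivity
    exact_mod_cast this.ne'
  rw [gHat, yHat, receivedPilot_mulVec X hq, g]
  change ((S.mmse m k : ℝ) : ℂ) * (((1 / √(K * S.pp k) : ℝ) : ℂ) * (((√(K * S.pp k) : ℝ) : ℂ) *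
    (((√(S.β m k) : ℝ) : ℂ) * X.h m k ω n) + (X.pilotNoise m ω *ᵥ S.q k) n)) = _
  push_cast
  field_simp

/-- The channel estimate in terms of the normalized estimate. -/
lemma gHat_eq (hq : S.OrthonormalPilots) (hβ : ∀ m k, 0 < S.β m k) (hpp : ∀ k, 0 < S.pp k)
    (m : Fin M) (k : Fin K) (ω : Ω) (n : Fin N) :
    S.gHat X m k ω n = (√(S.lam m k) : ℝ) * S.white X ω (.inl (m, k, n)) := by
  obtain ⟨h1, h2, -, -⟩ := sqrt_lam_mul_sqrt hβ hpp m k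
  rw [gHat_apply X hq hpp, white]
  simp only [whitening]
  rw [sum_mixRow_mul_entries, ← h2, mul_add, ← mul_assoc, ← mul_assoc, ← Complex.ofReal_mul,
    ← Complex.ofReal_mul, ← Complex.ofReal_mul, h1]

/-- The channel as the sum of its estimate and an estimation error. -/
lemma g_eq (hq : S.OrthonormalPilots) (hβ : ∀ m k, 0 < S.β m k) (hpp : ∀ k, 0 < S.pp k)
    (m : Fin M) (k : Fin K) (ω : Ω) (n : Fin N) :
    S.g X m k ω n = S.gHat X m k ω n
      + (√(S.β m k - S.lam m k) : ℝ) * S.white X ω (.inr (.inl (m, k, n))) := by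
  obtain ⟨-, -, h3, h4⟩ := sqrt_lam_mul_sqrt hβ hpp m k
  rw [gHat_apply X hq hpp, white]
  simp only [whitening]
  rw [sum_mixRow_mul_entries, ← h4, mul_add, ← mul_assoc, ← mul_assoc, ← Complex.ofReal_mul,
    ← Complex.ofReal_mul, h3, g]
  simp only [Pi.smul_apply, smul_eq_mul]
  push_cast
  ring

/-- The normalized estimates at access point `m`. -/
noncomputable def est (S : Params M N K) (X : RandomInputs M N K Ω) (m : Fin M) (ω : Ω) :
    Fin K × Fin N → ℂ :=
  fun p => S.white X ω (.inl (m, p.1, p.2))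

lemma GHat_eq (hq : S.OrthonormalPilots) (hβ : ∀ m k, 0 < S.β m k) (hpp : ∀ k, 0 < S.pp k)
    (m : Fin M) (ω : Ω) :
    S.GHat X m ω = scaledMatrix (fun k => √(S.lam m k)) (S.est X m ω) := by
  ext n k
  exact gHat_eq X hq hβ hpp m k ω n

lemma zfVec_eq (hq : S.OrthonormalPilots) (hβ : ∀ m k, 0 < S.β m k) (hpp : ∀ k, 0 < S.pp k)
    (m : Fin M) (k : Fin K) (ω : Ω) :
    S.zfVec X m k ω
      = zeroForcing (scaledMatrix (fun k => √(S.lam m k)) (S.est X m ω)) k := by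
  rw [← GHat_eq X hq hβ hpp]; rfl

end Params

/-! ### Bounds for the negative moment of the payload noise. -/

section Bounds

lemma norm_star_dotProduct_le {N : ℕ} (v w : Fin N → ℂ) :
    ‖star v ⬝ᵥ w‖ ≤ ‖WithLp.toLp 2 v‖ * ‖WithLp.toLp 2 w‖ := by
  have := norm_inner_le_norm (𝕜 := ℂ) (WithLp.toLp 2 v) (WithLp.toLp 2 w)
  rwa [EuclideanSpace.inner_eq_star_dotProduct, dotProduct_comm] at this

lemma rpow_half_le_one_add_sq (b : ENNReal) : b ^ (1 / 2 : ℝ) ≤ 1 + b ^ 2 := by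
  rcases le_total b 1 with hb | hb
  · refine le_add_right ?_
    exact ENNReal.rpow_le_one hb (by norm_num)
  · refine le_add_left ?_
    rw [← ENNReal.rpow_natCast]
    exact ENNReal.rpow_le_rpow_of_exponent_le hb (by norm_num)

/-- A lower bound `v ≥ 1/b` converts a negative moment of the combining norm into a positive moment
of `b`, which will be the norm of the channel estimate. -/
lemma rpow_neg_half_le {E v b r : ℝ} (hE : 0 < E) (hb : 0 ≤ b) (h1 : 1 ≤ v * b)
    (h2 : v / √E ≤ r) :
    ENNReal.ofReal r ^ (-(1 / 2) : ℝ) ≤ 1 + ENNReal.ofReal √E ^ 2 * ENNReal.ofReal b ^ 2 := by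
  have hsE : 0 < √E := Real.sqrt_pos.2 hE
  have hb0 : 0 < b := by
    rcases hb.eq_or_lt with h0 | h0
    · rw [← h0, mul_zero] at h1; linarith
    · exact h0
  have hc : 0 < √E * b := by positivity
  have h3 : (√E * b)⁻¹ ≤ r := by
    refine le_trans ?_ h2
    rw [inv_le_iff_one_le_mul₀ hc]
    calc (1 : ℝ) ≤ v * b := h1
      _ = v / √E * (√E * b) := by field_simp
  calc _ ≤ ENNReal.ofReal (√E * b)⁻¹ ^ (-(1 / 2) : ℝ) :=
        rpow_neg_le_rpow_neg (by norm_num) (ENNReal.ofReal_le_ofReal h3)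
    _ = ENNReal.ofReal (√E * b) ^ (1 / 2 : ℝ) := by
        rw [ENNReal.ofReal_inv_of_pos hc, ENNReal.inv_rpow, ENNReal.rpow_neg, inv_inv]
    _ ≤ 1 + ENNReal.ofReal (√E * b) ^ 2 := rpow_half_le_one_add_sq _
    _ = _ := by rw [ENNReal.ofReal_mul hsE.le, mul_pow]

end Bounds

/-! ### Signal, interference and noise powers under zero forcing. -/

namespace Params

variable {M N K : ℕ} {Ω : Type*} [MeasurableSpace Ω]

/-- Standard random inputs, orthonormal pilots, positive fading coefficients and pilot powers, and
more antennas than devices. -/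
structure IsRegular (S : Params M N K) (X : RandomInputs M N K Ω) (P : Measure Ω) : Prop where
  standard : X.IsStandard P
  pilots : S.OrthonormalPilots
  β_pos : ∀ m k, 0 < S.β m k
  pp_pos : ∀ k, 0 < S.pp k
  lt : K < N

variable {S : Params M N K} {X : RandomInputs M N K Ω} {P : Measure Ω}

lemma norm_toLp_a_sq (m : Fin M) (k : Fin K) (ω : Ω) :
    ‖WithLp.toLp 2 (S.a X P m k ω)‖ ^ 2
      = (∫ ω', ‖WithLp.toLp 2 (S.zfVec X m k ω')‖ ^ 2 ∂P)⁻¹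
        * ‖WithLp.toLp 2 (S.zfVec X m k ω)‖ ^ 2 := by
  have h0 : 0 ≤ ∫ ω', ‖WithLp.toLp 2 (S.zfVec X m k ω')‖ ^ 2 ∂P :=
    integral_nonneg fun ω => by positivity
  rw [a, WithLp.toLp_smul, norm_smul, mul_pow, Complex.norm_real, Real.norm_of_nonneg
    (by positivity), div_pow, Real.sq_sqrt h0, one_pow, one_div]

namespace IsRegular

lemma hasLaw_est [IsProbabilityMeasure P] (h : S.IsRegular X P) (m : Fin M) :
    HasLaw (S.est X m) (Measure.pi fun _ => stdCN) P := by
  refine (measurePreserving_reindex_stdCN (e := fun p : Fin K × Fin N =>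
    (Sum.inl (m, p.1, p.2) : (Fin M × Fin K × Fin N) ⊕ (Fin M × Fin K × Fin N) ⊕ (Fin M × Fin N)))
    fun p p' hp => ?_).comp_hasLaw (hasLaw_white h.standard h.pilots h.β_pos h.pp_pos)
  simp only [Sum.inl.injEq, Prod.mk.injEq, true_and] at hp
  exact Prod.ext hp.1 hp.2

lemma ae_isUnit [IsProbabilityMeasure P] (h : S.IsRegular X P) (m : Fin M) :
    ∀ᵐ ω ∂P, IsUnit ((S.GHat X m ω)ᴴ * S.GHat X m ω).det := by
  obtain ⟨d, hd⟩ := Nat.exists_eq_add_of_lt h.lt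
  have hli := ae_linearIndependent (d := d + 1) (N := N) (Nat.succ_pos d) (by omega)
    (fun k => √(S.lam m k)) (fun k => Real.sqrt_pos.2 (lam_pos h.β_pos h.pp_pos m k))
  have hlaw := h.hasLaw_est m
  rw [← hlaw.map_eq] at hli
  filter_upwards [ae_of_ae_map hlaw.aemeasurable hli] with ω hω
  rw [GHat_eq X h.pilots h.β_pos h.pp_pos]
  exact isUnit_gram_det_of_linearIndependent hω

lemma ae_star_zfVec_dotProduct [IsProbabilityMeasure P]
    (h : S.IsRegular X P) (m : Fin M) (k : Fin K) :
    ∀ᵐ ω ∂P, ∀ k', star (S.zfVec X m k ω) ⬝ᵥ S.gHat X m k' ω = if k' = k then 1 else 0 := by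
  filter_upwards [h.ae_isUnit m] with ω hω k'
  exact star_zeroForcing_dotProduct hω k k'

lemma aemeasurable_zfVec [IsProbabilityMeasure P] (h : S.IsRegular X P) (m : Fin M) (k : Fin K) :
    AEMeasurable (S.zfVec X m k) P := by
  have e : S.zfVec X m k = fun ω =>
      zeroForcing (scaledMatrix (fun k => √(S.lam m k)) (S.est X m ω)) k :=
    funext fun ω => zfVec_eq X h.pilots h.β_pos h.pp_pos m k ω
  rw [e]
  exact (measurable_zeroForcing_scaledMatrix _ k).comp_aemeasurable (h.hasLaw_est m).aemeasurable

lemma lintegral_normSq_zfVec_le [IsProbabilityMeasure P]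
    (h : S.IsRegular X P) (m : Fin M) (k : Fin K) :
    ∫⁻ ω, ENNReal.ofReal (‖WithLp.toLp 2 (S.zfVec X m k ω)‖ ^ 2) ∂P
      ≤ ENNReal.ofReal (1 / (S.lam m k * ((N : ℝ) - K))) := by
  obtain ⟨d, hd⟩ := Nat.exists_eq_add_of_lt h.lt
  have hlam := lam_pos h.β_pos h.pp_pos m k
  have hle := lintegral_normSq_zeroForcing_le (d := d + 1) (N := N) (Nat.succ_pos d) (by omega)
    (fun k => √(S.lam m k)) k (Real.sqrt_pos.2 hlam)
  have hmeas : Measurable fun z : Fin K × Fin N → ℂ => ENNReal.ofReal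
      (‖WithLp.toLp 2 (zeroForcing (scaledMatrix (fun k => √(S.lam m k)) z) k)‖ ^ 2) := by
    have := measurable_zeroForcing_scaledMatrix (N := N) (fun k => √(S.lam m k)) k
    fun_prop
  rw [← (h.hasLaw_est m).lintegral_comp hmeas.aemeasurable, Real.sq_sqrt hlam.le] at hle
  have e : (N : ℝ) - K = ((d + 1 : ℕ) : ℝ) := by rw [hd]; push_cast; ring
  rw [e]
  refine le_trans (le_of_eq (lintegral_congr fun ω => ?_)) hle
  rw [zfVec_eq X h.pilots h.β_pos h.pp_pos]

lemma integrable_normSq_zfVec [IsProbabilityMeasure P]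
    (h : S.IsRegular X P) (m : Fin M) (k : Fin K) :
    Integrable (fun ω => ‖WithLp.toLp 2 (S.zfVec X m k ω)‖ ^ 2) P := by
  have hm := h.aemeasurable_zfVec m k
  refine ⟨(by fun_prop : AEMeasurable _ P).aestronglyMeasurable, ?_⟩
  rw [hasFiniteIntegral_iff_ofReal (.of_forall fun ω => by positivity)]
  exact (h.lintegral_normSq_zfVec_le m k).trans_lt ENNReal.ofReal_lt_top

lemma integral_normSq_zfVec_le [IsProbabilityMeasure P]
    (h : S.IsRegular X P) (m : Fin M) (k : Fin K) :
    ∫ ω, ‖WithLp.toLp 2 (S.zfVec X m k ω)‖ ^ 2 ∂P ≤ 1 / (S.lam m k * ((N : ℝ) - K)) := by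
  have hle := h.lintegral_normSq_zfVec_le m k
  rw [← ofReal_integral_eq_lintegral_ofReal (h.integrable_normSq_zfVec m k)
    (.of_forall fun ω => by positivity)] at hle
  have hlam := lam_pos h.β_pos h.pp_pos m k
  have hNK : (0 : ℝ) < (N : ℝ) - K := sub_pos.2 (by exact_mod_cast h.lt)
  exact (ENNReal.ofReal_le_ofReal_iff (by positivity)).1 hle

lemma ae_zfVec_ne_zero [IsProbabilityMeasure P] (h : S.IsRegular X P) (m : Fin M) (k : Fin K) :
    ∀ᵐ ω ∂P, S.zfVec X m k ω ≠ 0 := by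
  filter_upwards [h.ae_star_zfVec_dotProduct m k] with ω hω h0
  simpa [h0] using hω k

/-- Without positivity the normalization in `a` would divide by zero and `E‖a‖² = 1` would fail. -/
lemma integral_normSq_zfVec_pos [IsProbabilityMeasure P]
    (h : S.IsRegular X P) (m : Fin M) (k : Fin K) :
    0 < ∫ ω, ‖WithLp.toLp 2 (S.zfVec X m k ω)‖ ^ 2 ∂P := by
  rw [integral_pos_iff_support_of_nonneg_ae (.of_forall fun ω => by positivity)
    (h.integrable_normSq_zfVec m k)]
  have : Function.support (fun ω => ‖WithLp.toLp 2 (S.zfVec X m k ω)‖ ^ 2) =ᵐ[P] Set.univ := by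
    filter_upwards [h.ae_zfVec_ne_zero m k] with ω hω
    refine propext ⟨fun _ => trivial, fun _ => ?_⟩
    change _ ≠ (0 : ℝ)
    simpa using hω
  rw [measure_congr this, measure_univ]
  exact one_pos

lemma integrable_normSq_a [IsProbabilityMeasure P] (h : S.IsRegular X P) (m : Fin M) (k : Fin K) :
    Integrable (fun ω => ‖WithLp.toLp 2 (S.a X P m k ω)‖ ^ 2) P := by
  simp_rw [norm_toLp_a_sq]
  exact (h.integrable_normSq_zfVec m k).const_mul _

lemma integral_normSq_a [IsProbabilityMeasure P] (h : S.IsRegular X P) (m : Fin M) (k : Fin K) :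
    ∫ ω, ‖WithLp.toLp 2 (S.a X P m k ω)‖ ^ 2 ∂P = 1 := by
  simp_rw [norm_toLp_a_sq]
  rw [integral_const_mul, inv_mul_cancel₀ (h.integral_normSq_zfVec_pos m k).ne']

end IsRegular

/-- The combining weights of device `k`, scaled by `w`, as a function of the normalized
estimates. -/
noncomputable def weights (S : Params M N K) (X : RandomInputs M N K Ω) (P : Measure Ω) (k : Fin K)
    (w : Fin M → ℝ) (z : Fin M × Fin K × Fin N → ℂ) : Fin M × Fin N → ℂ := fun p =>
  if p.1 ∈ S.serve k then
    w p.1 * star (((1 / √(∫ ω', ‖WithLp.toLp 2 (S.zfVec X p.1 k ω')‖ ^ 2 ∂P) : ℝ) : ℂ) *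
      zeroForcing (scaledMatrix (fun j => √(S.lam p.1 j)) fun r => z (p.1, r.1, r.2)) k p.2)
  else 0

/-- The normalized estimates at all access points. -/
noncomputable def allEst (S : Params M N K) (X : RandomInputs M N K Ω) (ω : Ω) :
    Fin M × Fin K × Fin N → ℂ :=
  fun p => S.white X ω (.inl p)

lemma measurable_weights (k : Fin K) (w : Fin M → ℝ) : Measurable (S.weights X P k w) := by
  refine measurable_pi_lambda _ fun p => ?_
  unfold weights
  split_ifs with hp
  · have h1 : Measurable fun z : Fin M × Fin K × Fin N → ℂ =>
        fun r : Fin K × Fin N => z (p.1, r.1, r.2) := by fun_prop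
    have h2 := (measurable_zeroForcing_scaledMatrix (fun j => √(S.lam p.1 j)) k).comp h1
    have h3 : Measurable fun z : Fin M × Fin K × Fin N → ℂ =>
        zeroForcing (scaledMatrix (fun j => √(S.lam p.1 j)) fun r => z (p.1, r.1, r.2)) k p.2 :=
      (measurable_pi_apply p.2).comp h2
    exact measurable_const.mul (continuous_star.measurable.comp (measurable_const.mul h3))
  · exact measurable_const

namespace IsRegular

lemma weights_eq (h : S.IsRegular X P) (k : Fin K) (w : Fin M → ℝ) (ω : Ω) (m : Fin M)
    (n : Fin N) :
    S.weights X P k w (S.allEst X ω) (m, n)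
      = if m ∈ S.serve k then w m * star (S.a X P m k ω n) else 0 := by
  unfold weights a
  rw [zfVec_eq X h.pilots h.β_pos h.pp_pos m k ω]
  rfl

lemma sum_weights (h : S.IsRegular X P) (k : Fin K) (w : Fin M → ℝ) (ω : Ω)
    (y : Fin M × Fin N → ℂ) :
    ∑ p, S.weights X P k w (S.allEst X ω) p * y p
      = ∑ m ∈ S.serve k, star (S.a X P m k ω) ⬝ᵥ fun n => (w m : ℂ) * y (m, n) := by
  rw [Fintype.sum_prod_type, ← Finset.sum_subset (Finset.subset_univ (S.serve k))]
  · refine Finset.sum_congr rfl fun m hm => Finset.sum_congr rfl fun n _ => ?_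
    rw [h.weights_eq, if_pos hm, Pi.star_apply]
    ring
  · intro m _ hm
    refine Finset.sum_eq_zero fun n _ => ?_
    rw [h.weights_eq, if_neg hm, zero_mul]

lemma sum_normSq_weights (h : S.IsRegular X P) (k : Fin K) (w : Fin M → ℝ) (ω : Ω) :
    ∑ p, ‖S.weights X P k w (S.allEst X ω) p‖ ^ 2
      = ∑ m ∈ S.serve k, w m ^ 2 * ‖WithLp.toLp 2 (S.a X P m k ω)‖ ^ 2 := by
  rw [Fintype.sum_prod_type, ← Finset.sum_subset (Finset.subset_univ (S.serve k))]
  · refine Finset.sum_congr rfl fun m hm => ?_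
    rw [EuclideanSpace.norm_sq_eq, Finset.mul_sum]
    refine Finset.sum_congr rfl fun n _ => ?_
    rw [h.weights_eq, if_pos hm, norm_mul, norm_star, mul_pow, Complex.norm_real, Real.norm_eq_abs,
      sq_abs]
  · intro m _ hm
    refine Finset.sum_eq_zero fun n _ => ?_
    rw [h.weights_eq, if_neg hm]
    simp

lemma integrable_sum_normSq_weights [IsProbabilityMeasure P]
    (h : S.IsRegular X P) (k : Fin K) (w : Fin M → ℝ) :
    Integrable (fun ω => ∑ p, ‖S.weights X P k w (S.allEst X ω) p‖ ^ 2) P := by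
  simp_rw [h.sum_normSq_weights]
  exact integrable_finsetSum _ fun m _ => (h.integrable_normSq_a m k).const_mul _

lemma integral_sum_normSq_weights [IsProbabilityMeasure P]
    (h : S.IsRegular X P) (k : Fin K) (w : Fin M → ℝ) :
    ∫ ω, ∑ p, ‖S.weights X P k w (S.allEst X ω) p‖ ^ 2 ∂P = ∑ m ∈ S.serve k, w m ^ 2 := by
  simp_rw [h.sum_normSq_weights]
  rw [integral_finsetSum _ fun m _ => (h.integrable_normSq_a m k).const_mul _]
  simp_rw [integral_const_mul, h.integral_normSq_a, mul_one]

/-- Estimates and errors are disjoint coordinate blocks of the whitened vector, hence independent.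
This allows conditioning on the combining vectors, which are functions of the estimates. -/
lemma hasLaw_allEst_error [IsProbabilityMeasure P] (h : S.IsRegular X P) (k' : Fin K) :
    HasLaw (fun ω => (S.allEst X ω,
        fun p : Fin M × Fin N => S.white X ω (.inr (.inl (p.1, k', p.2)))))
      ((Measure.pi fun _ => stdCN).prod (Measure.pi fun _ => stdCN)) P := by
  refine (measurePreserving_blocks_stdCN (e := Sum.inl)
    (e' := fun p : Fin M × Fin N => (Sum.inr (Sum.inl (p.1, k', p.2)) :
      (Fin M × Fin K × Fin N) ⊕ (Fin M × Fin K × Fin N) ⊕ (Fin M × Fin N))) ?_).comp_hasLaw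
      (hasLaw_white h.standard h.pilots h.β_pos h.pp_pos)
  refine Function.Injective.sumElim Sum.inl_injective (fun p p' hp => ?_) (fun _ _ => by simp)
  simp only [Sum.inr.injEq, Sum.inl.injEq, Prod.mk.injEq, true_and] at hp
  exact Prod.ext hp.1 hp.2

lemma hasLaw_allEst_noise [IsProbabilityMeasure P] (h : S.IsRegular X P) :
    HasLaw (fun ω => (S.allEst X ω, fun p : Fin M × Fin N => S.white X ω (.inr (.inr p))))
      ((Measure.pi fun _ => stdCN).prod (Measure.pi fun _ => stdCN)) P := by
  refine (measurePreserving_blocks_stdCN (e := Sum.inl)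
    (e' := fun p : Fin M × Fin N => (Sum.inr (Sum.inr p) :
      (Fin M × Fin K × Fin N) ⊕ (Fin M × Fin K × Fin N) ⊕ (Fin M × Fin N))) ?_).comp_hasLaw
      (hasLaw_white h.standard h.pilots h.β_pos h.pp_pos)
  refine Function.Injective.sumElim Sum.inl_injective (fun p p' hp => ?_) (fun _ _ => by simp)
  simpa using hp

end IsRegular

/-- The contribution of the estimation errors of device `k'` after combining for device `k`. -/
noncomputable def errorTerm (S : Params M N K) (X : RandomInputs M N K Ω) (P : Measure Ω)
    (k k' : Fin K) (ω : Ω) : ℂ :=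
  ∑ p, S.weights X P k (fun m => √(S.β m k' - S.lam m k')) (S.allEst X ω) p
    * S.white X ω (.inr (.inl (p.1, k', p.2)))

/-- The mean effective channel gain of device `k`. -/
noncomputable def meanGain (S : Params M N K) (X : RandomInputs M N K Ω) (P : Measure Ω)
    (k : Fin K) : ℝ :=
  ∑ m ∈ S.serve k, 1 / √(∫ ω, ‖WithLp.toLp 2 (S.zfVec X m k ω)‖ ^ 2 ∂P)

namespace IsRegular

lemma integrable_errorTerm [IsProbabilityMeasure P] (h : S.IsRegular X P) (k k' : Fin K) :
    Integrable (S.errorTerm X P k k') P ∧ ∫ ω, S.errorTerm X P k k' ω ∂P = 0 :=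
  integral_combination (h.hasLaw_allEst_error k') (measurable_weights k _)
    (h.integrable_sum_normSq_weights k _)

lemma integrable_normSq_errorTerm [IsProbabilityMeasure P] (h : S.IsRegular X P) (k k' : Fin K) :
    Integrable (fun ω => ‖S.errorTerm X P k k' ω‖ ^ 2) P ∧
      ∫ ω, ‖S.errorTerm X P k k' ω‖ ^ 2 ∂P = ∑ m ∈ S.serve k, (S.β m k' - S.lam m k') := by
  obtain ⟨h1, h2⟩ := integrable_normSq_combination (h.hasLaw_allEst_error k')
    (measurable_weights k _) (h.integrable_sum_normSq_weights k
      (fun m => √(S.β m k' - S.lam m k')))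
  refine ⟨h1, h2.trans ?_⟩
  rw [h.integral_sum_normSq_weights]
  exact Finset.sum_congr rfl fun m _ => Real.sq_sqrt (sub_lam_pos h.β_pos h.pp_pos m k').le

lemma Nk_eq (h : S.IsRegular X P) (k : Fin K) (ω : Ω) :
    S.Nk X P k ω = ∑ p, S.weights X P k 1 (S.allEst X ω) p * S.white X ω (.inr (.inr p)) := by
  rw [h.sum_weights, Nk]
  refine Finset.sum_congr rfl fun m _ => ?_
  congr 1
  ext n
  rw [S.noise_eq]
  simp

lemma integrable_normSq_Nk [IsProbabilityMeasure P] (h : S.IsRegular X P) (k : Fin K) :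
    Integrable (fun ω => ‖S.Nk X P k ω‖ ^ 2) P ∧
      ∫ ω, ‖S.Nk X P k ω‖ ^ 2 ∂P = (S.serve k).card := by
  obtain ⟨h1, h2⟩ := integrable_normSq_combination h.hasLaw_allEst_noise
    (measurable_weights k 1) (h.integrable_sum_normSq_weights k 1)
  simp_rw [h.Nk_eq]
  refine ⟨h1, h2.trans ?_⟩
  rw [h.integral_sum_normSq_weights]
  simp

/-- Zero forcing removes the estimated channels of the other devices. -/
lemma ae_sum_dotProduct_g [IsProbabilityMeasure P] (h : S.IsRegular X P) (k : Fin K) :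
    ∀ᵐ ω ∂P, ∀ k', ∑ m ∈ S.serve k, star (S.a X P m k ω) ⬝ᵥ S.g X m k' ω
      = (if k' = k then (S.meanGain X P k : ℂ) else 0) + S.errorTerm X P k k' ω := by
  have hall : ∀ᵐ ω ∂P, ∀ m k', star (S.zfVec X m k ω) ⬝ᵥ S.gHat X m k' ω
      = if k' = k then 1 else 0 := ae_all_iff.2 fun m => h.ae_star_zfVec_dotProduct m k
  filter_upwards [hall] with ω hω k'
  rw [errorTerm, h.sum_weights k _ ω (fun p => S.white X ω (.inr (.inl (p.1, k', p.2)))),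
    meanGain]
  have hg : ∀ m, star (S.a X P m k ω) ⬝ᵥ S.g X m k' ω
      = star (S.a X P m k ω) ⬝ᵥ S.gHat X m k' ω + star (S.a X P m k ω) ⬝ᵥ fun n =>
        ((√(S.β m k' - S.lam m k') : ℝ) : ℂ) * S.white X ω (.inr (.inl (m, k', n))) := fun m => by
    rw [← dotProduct_add]
    congr 1
    ext n
    exact g_eq X h.pilots h.β_pos h.pp_pos m k' ω n
  simp_rw [hg]
  rw [Finset.sum_add_distrib]
  congr 1
  have ha : ∀ m, star (S.a X P m k ω) ⬝ᵥ S.gHat X m k' ω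
      = ((1 / √(∫ ω', ‖WithLp.toLp 2 (S.zfVec X m k ω')‖ ^ 2 ∂P) : ℝ) : ℂ)
        * if k' = k then 1 else 0 := fun m => by
    rw [a, star_smul, smul_dotProduct, hω, smul_eq_mul]
    congr 1
    exact Complex.conj_ofReal _
  simp_rw [ha]
  split_ifs <;> simp

lemma integral_sum_dotProduct_g [IsProbabilityMeasure P] (h : S.IsRegular X P) (k : Fin K) :
    ∫ ω, ∑ m ∈ S.serve k, star (S.a X P m k ω) ⬝ᵥ S.g X m k ω ∂P = S.meanGain X P k := by
  obtain ⟨h1, h2⟩ := h.integrable_errorTerm k k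
  have : (fun ω => ∑ m ∈ S.serve k, star (S.a X P m k ω) ⬝ᵥ S.g X m k ω)
      =ᵐ[P] fun ω => (S.meanGain X P k : ℂ) + S.errorTerm X P k k ω := by
    filter_upwards [h.ae_sum_dotProduct_g k] with ω hω
    rw [hω k, if_pos rfl]
  rw [integral_congr_ae this, integral_add (integrable_const _) h1, h2]
  simp

lemma norm_DS_sq [IsProbabilityMeasure P] (h : S.IsRegular X P) (k : Fin K) (hpd : 0 ≤ S.pd k) :
    ‖S.DS X P k‖ ^ 2 = S.pd k * S.meanGain X P k ^ 2 := by
  have : S.DS X P k = S.meanGain X P k * ((√(S.pd k) : ℝ) : ℂ) := by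
    rw [DS]
    simp_rw [← Finset.sum_mul]
    rw [integral_mul_const, h.integral_sum_dotProduct_g]
  rw [this, norm_mul, mul_pow, Complex.norm_real, Complex.norm_real, Real.norm_eq_abs,
    Real.norm_eq_abs, sq_abs, sq_abs, Real.sq_sqrt hpd, mul_comm]

/-- The interference power in the denominator of the SINR. -/
lemma ae_denominator_eq [IsProbabilityMeasure P]
    (h : S.IsRegular X P) (k : Fin K) (hpd : ∀ k, 0 ≤ S.pd k) :
    ∀ᵐ ω ∂P, ‖S.LS X P k ω‖ ^ 2 + ∑ k' ∈ Finset.univ.erase k, ‖S.UI X P k k' ω‖ ^ 2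
        + ‖S.Nk X P k ω‖ ^ 2
      = ∑ k', S.pd k' * ‖S.errorTerm X P k k' ω‖ ^ 2 + ‖S.Nk X P k ω‖ ^ 2 := by
  filter_upwards [h.ae_sum_dotProduct_g k] with ω hω
  have hsq : ∀ k', ‖((√(S.pd k') : ℝ) : ℂ)‖ ^ 2 = S.pd k' := fun k' => by
    rw [Complex.norm_real, Real.norm_eq_abs, sq_abs, Real.sq_sqrt (hpd k')]
  -- The deterministic gain cancels against the mean, so the leakage is precisely the missing `k' =
  -- k` term of the interference sum.
  have hLS : ‖S.LS X P k ω‖ ^ 2 = S.pd k * ‖S.errorTerm X P k k ω‖ ^ 2 := by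
    rw [LS, h.integral_sum_dotProduct_g, hω k, if_pos rfl, add_sub_cancel_left, norm_mul, mul_pow,
      hsq]
  have hUI : ∀ k' ∈ Finset.univ.erase k,
      ‖S.UI X P k k' ω‖ ^ 2 = S.pd k' * ‖S.errorTerm X P k k' ω‖ ^ 2 := fun k' hk' => by
    rw [UI, ← Finset.sum_mul, hω k', if_neg (Finset.ne_of_mem_erase hk'), zero_add, norm_mul,
      mul_pow, hsq, mul_comm]
  rw [hLS, Finset.sum_congr rfl hUI, Finset.add_sum_erase Finset.univ
    (fun k' => S.pd k' * ‖S.errorTerm X P k k' ω‖ ^ 2) (Finset.mem_univ k)]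

/-- An upper bound on `E‖v‖²` bounds the normalized gain from below; equality is not needed, since a
larger signal only lowers the inverse SINR. -/
lemma sqrt_lam_le [IsProbabilityMeasure P] (h : S.IsRegular X P) (m : Fin M) (k : Fin K) :
    √((N : ℝ) - K) * √(S.lam m k)
      ≤ 1 / √(∫ ω, ‖WithLp.toLp 2 (S.zfVec X m k ω)‖ ^ 2 ∂P) := by
  have hlam := lam_pos h.β_pos h.pp_pos m k
  have hNK : (0 : ℝ) < (N : ℝ) - K := sub_pos.2 (by exact_mod_cast h.lt)
  have hE := h.integral_normSq_zfVec_pos m k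
  have hle := h.integral_normSq_zfVec_le m k
  rw [← Real.sqrt_mul hNK.le, one_div, ← Real.sqrt_inv]
  refine Real.sqrt_le_sqrt ?_
  rw [← one_div, le_div_iff₀ hE, ← le_div_iff₀' (by positivity), mul_comm]
  exact hle

lemma sum_sqrt_lam_le_meanGain [IsProbabilityMeasure P] (h : S.IsRegular X P) (k : Fin K) :
    √((N : ℝ) - K) * ∑ m ∈ S.serve k, √(S.lam m k) ≤ S.meanGain X P k := by
  rw [Finset.mul_sum]
  exact Finset.sum_le_sum fun m _ => h.sqrt_lam_le m k

lemma lintegral_sq_white [IsProbabilityMeasure P] (h : S.IsRegular X P)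
    (j : (Fin M × Fin K × Fin N) ⊕ (Fin M × Fin K × Fin N) ⊕ (Fin M × Fin N)) :
    ∫⁻ ω, ‖S.white X ω j‖ₑ ^ 2 ∂P = 1 := by
  have hlaw : HasLaw (fun ω => S.white X ω j) stdCN P :=
    (measurePreserving_eval (fun _ => stdCN) j).comp_hasLaw
      (hasLaw_white h.standard h.pilots h.β_pos h.pp_pos)
  rw [hlaw.lintegral_comp (f := fun z => ‖z‖ₑ ^ 2) (by fun_prop : Measurable _).aemeasurable,
    lintegral_sq_stdCN]

lemma lintegral_normSq_gHat_lt_top [IsProbabilityMeasure P]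
    (h : S.IsRegular X P) (m : Fin M) (k : Fin K) :
    ∫⁻ ω, ENNReal.ofReal ‖WithLp.toLp 2 (S.gHat X m k ω)‖ ^ 2 ∂P < ⊤ := by
  have hw := hasLaw_white h.standard h.pilots h.β_pos h.pp_pos (X := X) (P := P)
  have e : ∀ ω, ENNReal.ofReal ‖WithLp.toLp 2 (S.gHat X m k ω)‖ ^ 2
      = ∑ n, ‖((√(S.lam m k) : ℝ) : ℂ)‖ₑ ^ 2 * ‖S.white X ω (.inl (m, k, n))‖ₑ ^ 2 := fun ω => by
    rw [← ENNReal.ofReal_pow (norm_nonneg _), EuclideanSpace.norm_sq_eq,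
      ENNReal.ofReal_sum_of_nonneg fun _ _ => by positivity]
    refine Finset.sum_congr rfl fun n _ => ?_
    rw [ENNReal.ofReal_pow (norm_nonneg _), ofReal_norm, ← mul_pow, ← enorm_mul,
      ← gHat_eq X h.pilots h.β_pos h.pp_pos]
  have hm : ∀ j, AEMeasurable (fun ω => S.white X ω j) P := fun j =>
    (measurable_pi_apply j).comp_aemeasurable hw.aemeasurable
  simp_rw [e]
  rw [lintegral_finsetSum' _ fun n _ => ((hm _).enorm.pow_const 2).const_mul _]
  refine ENNReal.sum_lt_top.2 fun n _ => ?_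
  rw [lintegral_const_mul'' _ ((hm _).enorm.pow_const 2), h.lintegral_sq_white, mul_one]
  exact ENNReal.pow_lt_top enorm_lt_top

/-- The combined payload noise has a finite negative moment. -/
lemma lintegral_rpow_neg_half_Nk_lt_top [IsProbabilityMeasure P] (h : S.IsRegular X P) (k : Fin K)
    (hserve : (S.serve k).Nonempty) :
    ∫⁻ ω, ‖S.Nk X P k ω‖ₑ ^ (-(1 / 2) : ℝ) ∂P < ⊤ := by
  simp_rw [h.Nk_eq]
  rw [lintegral_rpow_neg_half_combination h.hasLaw_allEst_noise (measurable_weights k 1)]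
  refine ENNReal.mul_lt_top ?_ lintegral_rpow_neg_half_stdCN_lt_top
  obtain ⟨m, hm⟩ := hserve
  set E := ∫ ω', ‖WithLp.toLp 2 (S.zfVec X m k ω')‖ ^ 2 ∂P with hE
  have hEpos : 0 < E := h.integral_normSq_zfVec_pos m k
  have hbound : ∀ᵐ ω ∂P,
      (ENNReal.ofReal √(∑ p, ‖S.weights X P k 1 (S.allEst X ω) p‖ ^ 2)) ^ (-(1 / 2) : ℝ)
        ≤ 1 + ENNReal.ofReal √E ^ 2 * ENNReal.ofReal ‖WithLp.toLp 2 (S.gHat X m k ω)‖ ^ 2 := by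
    filter_upwards [h.ae_star_zfVec_dotProduct m k] with ω hω
    refine rpow_neg_half_le (v := ‖WithLp.toLp 2 (S.zfVec X m k ω)‖) hEpos (norm_nonneg _)
      ?_ ?_
    -- By Cauchy–Schwarz, `1 = |vᴴ ĝ| ≤ ‖v‖ ‖ĝ‖`, so `v` is small only where the estimate is large.
    · have := norm_star_dotProduct_le (S.zfVec X m k ω) (S.gHat X m k ω)
      rwa [hω k, if_pos rfl, norm_one] at this
    -- One serving access point suffices; the others only increase the total combining norm.
    · refine Real.le_sqrt_of_sq_le ?_
      rw [h.sum_normSq_weights]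
      refine le_trans (le_of_eq ?_) (Finset.single_le_sum
        (f := fun m => (1 : Fin M → ℝ) m ^ 2 * ‖WithLp.toLp 2 (S.a X P m k ω)‖ ^ 2)
        (fun _ _ => by positivity) hm)
      rw [Pi.one_apply, one_pow, one_mul, norm_toLp_a_sq, div_pow, Real.sq_sqrt hEpos.le,
        div_eq_inv_mul]
  refine (lintegral_mono_ae hbound).trans_lt ?_
  rw [lintegral_add_left measurable_const, lintegral_const_mul' _ _
    (ENNReal.pow_ne_top ENNReal.ofReal_ne_top)]
  refine ENNReal.add_lt_top.2 ⟨by simp, ENNReal.mul_lt_top ?_ (h.lintegral_normSq_gHat_lt_top m k)⟩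
  exact ENNReal.pow_lt_top ENNReal.ofReal_lt_top

end IsRegular

end Params

end CellFree

/-! ### Assembly of the rate bound. -/

open MeasureTheory in
/-- The ergodic rate of the zero-forcing decoder is at least the rate at the closed-form SINR. -/
theorem theorem2 {M N K : ℕ} {Ω : Type*} [MeasurableSpace Ω]
    (P : MeasureTheory.Measure Ω) [MeasureTheory.IsProbabilityMeasure P]
    (S : CellFree.Params M N K) (X : CellFree.RandomInputs M N K Ω)
    (hX : X.IsStandard P) (hq : S.OrthonormalPilots)
    (hB : 0 < S.B) (hKL : K < S.L) (hKN : K < N)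
    (hβ : ∀ m k, 0 < S.β m k) (hpp : ∀ k, 0 < S.pp k) (hpd : ∀ k, 0 ≤ S.pd k)
    (k : Fin K) (hpdk : 0 < S.pd k) (hserve : (S.serve k).Nonempty)
    (hε0 : 0 < S.ε k) (hε : S.ε k ≤ 1 / 2)
    (hfeas : S.α k ≤ CellFree.gFun (1 / S.gammaFZF k)) :
    MeasureTheory.Integrable (fun ω => S.fblRate k (S.sinr X P k ω)) P ∧
      S.B * ((1 - S.η) / Real.log 2) * S.f k (1 / S.gammaFZF k) ≤ S.ergodicRate X P k := by
  have h : S.IsRegular X P := ⟨hX, hq, hβ, hpp, hKN⟩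
  have hNK : (0 : ℝ) < (N : ℝ) - K := sub_pos.2 (by exact_mod_cast hKN)
  set A := ∑ m ∈ S.serve k, √(S.lam m k) with hA
  have hApos : 0 < A := Finset.sum_pos
    (fun m _ => Real.sqrt_pos.2 (CellFree.Params.lam_pos hβ hpp m k)) hserve
  have hgain : √((N : ℝ) - K) * A ≤ S.meanGain X P k := h.sum_sqrt_lam_le_meanGain k
  set D := S.pd k * S.meanGain X P k ^ 2 with hD
  set D' := S.pd k * ((N : ℝ) - K) * A ^ 2 with hD'
  have hD'pos : 0 < D' := by positivity
  -- `D` is the true signal power and `D'` its closed-form lower bound, so the mean inverse SINR `I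
  -- / D` is at most `I / D'`.
  have hDD' : D' ≤ D := by
    have h1 : (√((N : ℝ) - K) * A) ^ 2 ≤ S.meanGain X P k ^ 2 := by gcongr
    rw [mul_pow, Real.sq_sqrt hNK.le] at h1
    calc D' = S.pd k * (((N : ℝ) - K) * A ^ 2) := by rw [hD']; ring
      _ ≤ D := mul_le_mul_of_nonneg_left h1 hpdk.le
  have hDpos : 0 < D := hD'pos.trans_le hDD'
  set I : ℝ := (S.serve k).card + ∑ k', S.pd k' * ∑ m ∈ S.serve k, (S.β m k' - S.lam m k') with hI
  have hIpos : 0 < I := by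
    have h1 : (0 : ℝ) < (S.serve k).card := by exact_mod_cast hserve.card_pos
    have h2 : 0 ≤ ∑ k', S.pd k' * ∑ m ∈ S.serve k, (S.β m k' - S.lam m k') :=
      Finset.sum_nonneg fun k' _ => mul_nonneg (hpd k') (Finset.sum_nonneg fun m _ =>
        (CellFree.Params.sub_lam_pos hβ hpp m k').le)
    linarith
  have hgamma : 1 / S.gammaFZF k = I / D' := by
    rw [CellFree.Params.gammaFZF, one_div_div]
  set y : Ω → ℝ := fun ω => ∑ k', S.pd k' * ‖S.errorTerm X P k k' ω‖ ^ 2 + ‖S.Nk X P k ω‖ ^ 2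
    with hy
  have herr : ∀ k', Integrable (fun ω => S.pd k' * ‖S.errorTerm X P k k' ω‖ ^ 2) P := fun k' =>
    (h.integrable_normSq_errorTerm k k').1.const_mul _
  have hsum : Integrable (fun ω => ∑ k', S.pd k' * ‖S.errorTerm X P k k' ω‖ ^ 2) P :=
    integrable_finsetSum _ fun k' _ => herr k'
  have hyint : Integrable y P := hsum.add (h.integrable_normSq_Nk k).1
  have hymean : ∫ ω, y ω ∂P = I := by
    rw [integral_add hsum (h.integrable_normSq_Nk k).1, integral_finsetSum _ fun k' _ => herr k',
      (h.integrable_normSq_Nk k).2, add_comm]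
    simp_rw [integral_const_mul, (h.integrable_normSq_errorTerm k _).2]
    rfl
  have hNm : AEMeasurable (S.Nk X P k) P := by
    have : S.Nk X P k = fun ω => ∑ p, S.weights X P k 1 (S.allEst X ω) p
        * S.white X ω (.inr (.inr p)) := funext fun ω => h.Nk_eq k ω
    rw [this]
    exact CellFree.aemeasurable_combination h.hasLaw_allEst_noise
      (CellFree.Params.measurable_weights k 1)
  -- Dropping the nonnegative error terms leaves the payload noise as a lower bound for the
  -- denominator.
  obtain ⟨hxpos, hlog⟩ := CellFree.integrable_log_one_add_inv (x := fun ω => y ω / D) hDpos hNm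
    (hyint.div_const D).aemeasurable (h.lintegral_rpow_neg_half_Nk_lt_top k hserve)
    (.of_forall fun ω => by
      refine div_le_div_of_nonneg_right ?_ hDpos.le
      exact le_add_of_nonneg_left
        (Finset.sum_nonneg fun k' _ => mul_nonneg (hpd k') (by positivity)))
  rw [hgamma] at hfeas ⊢
  refine S.integrable_fblRate_and_le hB hKL k hε0 hε (by positivity) hfeas ?_ hxpos
    (hyint.div_const D) ?_ hlog
  · filter_upwards [h.ae_denominator_eq k hpd] with ω hω
    rw [CellFree.Params.sinr, hω, h.norm_DS_sq k hpdk.le, one_div_div]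
  · rw [integral_div, hymean]
    exact div_le_div_of_nonneg_left hIpos.le hD'pos hDD'
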